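/- Let $p$ be an odd prime and let $F$ be a field containing a primitive $p$th root of unity. Write $K^p=\{c^p : c\in K\}$ for a field $K$. An element $a\in K\smallsetminus K^p$ is called $p$-rigid if every norm $b\in N_{K(\sqrt[p]{a})/K}\bigl(K(\sqrt[p]{a})\bigr)$ lies in $a^kK^p$ for some integer $k\ge 0$, and the field $K$ is called $p$-rigid if every element of $K\smallsetminus K^p$ is $p$-rigid. Let $F(p)$ denote the maximal $p$-extension of $F$, i.e. the compositum, inside a separable closure of $F$, of all finite Galois extensions of $F$ of $p$-power degree. Suppose that $F$ is $p$-rigid. Then: 1. $F$ is hereditarily $p$-rigid, that is, every field $K$ with $F\subseteq K\subseteq F(p)$ (of finite or infinite degree over $F$) is $p$-rigid. 2. In particular, for every $a\in F\smallsetminus F^p$ the field $E=F(\sqrt[p]{a})$ is $p$-rigid. -/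

import Mathlib

open Polynomial

/-- The set `F ^ p` of `p`-th powers of elements of `F` (it contains `0` when `p` is nonzero). -/
def pthPowers (p : ℕ) (F : Type*) [Field F] : Set F :=
  Set.range fun c : F => c ^ p

/-- For `p` prime and `a` not a `p`-th power, `X ^ p - a` is irreducible, so that
`AdjoinRoot (X ^ p - C a)` is the field obtained from `F` by adjoining a `p`-th root of `a`. -/
theorem irreducible_X_pow_sub_C_of_notMem_pthPowers {p : ℕ} (hp : p.Prime)
    {F : Type*} [Field F] {a : F} (ha : a ∉ pthPowers p F) :
    Irreducible (X ^ p - C a : F[X]) :=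
  X_pow_sub_C_irreducible_of_prime hp fun c hc => ha ⟨c, hc⟩

/-- An element `a` of `F` outside `F ^ p` is `p`-rigid if every norm `b = N y` from
the field `F[X] / (X ^ p - a)` down to `F` is of the form `a ^ k * c ^ p`. -/
def IsPRigidElement (p : ℕ) {F : Type*} [Field F] (a : F) : Prop :=
  a ∉ pthPowers p F ∧
    ∀ y : AdjoinRoot (X ^ p - C a : F[X]),
      ∃ (k : ℕ) (c : F), Algebra.norm F y = a ^ k * c ^ p

/-- A field is `p`-rigid if all of its elements outside `F ^ p` are `p`-rigid. -/
def IsPRigidField (p : ℕ) (F : Type*) [Field F] : Prop :=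
  ∀ a : F, a ∉ pthPowers p F → IsPRigidElement p a

/-- The maximal `p`-extension of `F`: the compositum, in a separable closure of `F`, of all finite
Galois extensions of `F` whose degree is a power of `p`. -/
noncomputable def maximalPExtension (p : ℕ) (F : Type*) [Field F] :
    IntermediateField F (SeparableClosure F) :=
  sSup {K : IntermediateField F (SeparableClosure F) |
    FiniteDimensional F K ∧ IsGalois F K ∧ ∃ n : ℕ, Module.finrank F K = p ^ n}

/-- A field `F` is hereditarily `p`-rigid if every subextension, finite or infinite, of its maximal
`p`-extension is a `p`-rigid field. -/
def IsHereditarilyPRigid (p : ℕ) (F : Type*) [Field F] : Prop :=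
  ∀ K : IntermediateField F (SeparableClosure F), K ≤ maximalPExtension p F → IsPRigidField p K

/-! Write [x] for the class of x in the vector space of nonzero elements modulo p-th powers over the
field with p elements. If α^p = a, then 1 - a is the norm of 1 - α, so p-rigidity says that [1 - x]
is a multiple k[x] whenever [x] ≠ 0 (`IsPRigidField.isAdditivelyRigid`). This additive condition
already produces a valuation ring whose principal units 1 + m are p-th powers and whose units have
classes on a single line (`IsAdditivelyRigid.hasRigidValuation`).

To find it, note that [x + y] lies on the affine line through [x] and [y]. A barycentric argument
(`IsAdditivelyRigid.ceva`) shows that coefficients k other than 0 and 1 occur on at most one line H.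
Outside H, exactly one of x and its inverse is small, meaning that [1 - x] = 0. Small elements,
together with the elements with class in H that preserve smallness, form the valuation ring,
possibly after choosing H to absorb an exceptional pair.

Such a valuation is easier to transport than rigidity. Extended to E = F(α), it makes the powers of
α, after rescaling, a valuation basis: E is either totally ramified or has a residue extension of
degree p. Hence the valuation is Galois invariant and norms can be read off, which gives rigidity of
F back (`HasRigidValuation.isPRigidField`). Hilbert 90 then shows that E is generated modulo p-th
powers by α and F, so E inherits a rigid valuation (`HasRigidValuation.of_isKummerGenerator`). Every
intermediate field of a finite Galois p-extension is reached by Kummer steps of degree p, and an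
infinite subextension is handled through its finitely generated subfields. -/

/-- The group `Fˣ / (Fˣ) ^ p`, written additively. -/
def PowerClassGroup (p : ℕ) (F : Type*) [Field F] : Type _ :=
  Additive (Fˣ ⧸ (powMonoidHom p : Fˣ →* Fˣ).range)

noncomputable instance (p : ℕ) (F : Type*) [Field F] : AddCommGroup (PowerClassGroup p F) :=
  inferInstanceAs (AddCommGroup (Additive (Fˣ ⧸ (powMonoidHom p : Fˣ →* Fˣ).range)))

/-- The projection from `Fˣ` to `Fˣ / (Fˣ) ^ p`. -/
def PowerClassGroup.mk (p : ℕ) {F : Type*} [Field F] :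
    Additive Fˣ →+ PowerClassGroup p F :=
  MonoidHom.toAdditive (QuotientGroup.mk' (powMonoidHom p : Fˣ →* Fˣ).range)

theorem PowerClassGroup.mk_surjective (p : ℕ) (F : Type*) [Field F] :
    Function.Surjective (PowerClassGroup.mk p (F := F)) :=
  QuotientGroup.mk'_surjective (powMonoidHom p : Fˣ →* Fˣ).range

theorem PowerClassGroup.mk_eq_zero_iff {p : ℕ} {F : Type*} [Field F] {x : Fˣ} :
    PowerClassGroup.mk p (Additive.ofMul x) = 0 ↔ ∃ c : Fˣ, c ^ p = x :=
  QuotientGroup.eq_one_iff (N := (powMonoidHom p : Fˣ →* Fˣ).range) x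

noncomputable instance (p : ℕ) (F : Type*) [Field F] : Module (ZMod p) (PowerClassGroup p F) :=
  AddCommGroup.zmodModule fun x => by
    obtain ⟨x, rfl⟩ := PowerClassGroup.mk_surjective p F x
    rw [← map_nsmul]
    exact PowerClassGroup.mk_eq_zero_iff.2 ⟨x.toMul, rfl⟩

/-- The class of `x` modulo `p`-th powers; the class of `0` is `0`. -/
noncomputable def powerClass (p : ℕ) {F : Type*} [Field F] (x : F) : PowerClassGroup p F :=
  open Classical in
  if h : x = 0 then 0 else PowerClassGroup.mk p (Additive.ofMul (Units.mk0 x h))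

/-! ### Calculus of classes modulo p-th powers -/

section PowerClass

variable {p : ℕ} {F : Type*} [Field F]

@[simp] theorem powerClass_zero : powerClass p (0 : F) = 0 := by simp [powerClass]

theorem powerClass_of_ne_zero {x : F} (h : x ≠ 0) :
    powerClass p x = PowerClassGroup.mk p (Additive.ofMul (Units.mk0 x h)) := by simp [powerClass, h]

theorem powerClass_mul {x y : F} (hx : x ≠ 0) (hy : y ≠ 0) :
    powerClass p (x * y) = powerClass p x + powerClass p y := by
  rw [powerClass_of_ne_zero hx, powerClass_of_ne_zero hy, powerClass_of_ne_zero (mul_ne_zero hx hy),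
    ← map_add, ← ofMul_mul]
  congr 2
  ext; simp

theorem powerClass_eq_zero_iff (hp : p ≠ 0) {x : F} : powerClass p x = 0 ↔ x ∈ pthPowers p F := by
  by_cases h : x = 0
  · subst h
    simpa using ⟨0, by simp [hp]⟩
  · rw [powerClass_of_ne_zero h, PowerClassGroup.mk_eq_zero_iff]
    constructor
    · rintro ⟨c, hc⟩
      exact ⟨c, by simpa using congrArg Units.val hc⟩
    · rintro ⟨c, hc⟩
      have hc0 : c ≠ 0 := by rintro rfl; exact h (by simp [← hc, hp])
      exact ⟨Units.mk0 c hc0, by ext; simpa using hc⟩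

@[simp] theorem powerClass_one : powerClass p (1 : F) = 0 := by
  rw [powerClass_of_ne_zero one_ne_zero, PowerClassGroup.mk_eq_zero_iff]
  exact ⟨1, by ext; simp⟩

theorem powerClass_inv (x : F) : powerClass p x⁻¹ = -powerClass p x := by
  by_cases h : x = 0
  · simp [h]
  · have := powerClass_mul (p := p) h (inv_ne_zero h)
    rw [mul_inv_cancel₀ h, powerClass_one] at this
    exact (neg_eq_of_add_eq_zero_right this.symm).symm

theorem powerClass_div {x y : F} (hx : x ≠ 0) (hy : y ≠ 0) :
    powerClass p (x / y) = powerClass p x - powerClass p y := by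
  rw [div_eq_mul_inv, powerClass_mul hx (inv_ne_zero hy), powerClass_inv, sub_eq_add_neg]

theorem powerClass_pow (x : F) (n : ℕ) : powerClass p (x ^ n) = (n : ZMod p) • powerClass p x := by
  by_cases h : x = 0
  · subst h
    rcases n with _ | n <;> simp
  · induction n with
    | zero => simp
    | succ n ih => rw [pow_succ, powerClass_mul (pow_ne_zero n h) h, ih]; push_cast; module

theorem powerClass_pow_self (x : F) : powerClass p (x ^ p) = 0 := by
  rw [powerClass_pow]; simp

theorem powerClass_neg (hp : Odd p) (x : F) : powerClass p (-x) = powerClass p x := by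
  by_cases h : x = 0
  · simp [h]
  · have h1 : powerClass p (-1 : F) = 0 := by
      have := powerClass_pow_self (p := p) (-1 : F)
      rwa [hp.neg_one_pow] at this
    rw [← neg_one_mul, powerClass_mul (by simp) h, h1, zero_add]

theorem ne_zero_of_powerClass_ne_zero {x : F} (h : powerClass p x ≠ 0) : x ≠ 0 := by
  rintro rfl; simp at h

theorem exists_powerClass_eq (v : PowerClassGroup p F) : ∃ x : F, x ≠ 0 ∧ powerClass p x = v := by
  obtain ⟨v, rfl⟩ := PowerClassGroup.mk_surjective p F v
  refine ⟨v.toMul, v.toMul.ne_zero, ?_⟩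
  rw [powerClass_of_ne_zero v.toMul.ne_zero]
  simp

/-- Membership of the class of `x` in the line spanned by the class of `a`, in multiplicative
terms. -/
theorem exists_powerClass_eq_smul_iff (hp : p.Prime) {a x : F} (ha : a ≠ 0) :
    (∃ k : ZMod p, powerClass p x = k • powerClass p a) ↔
      ∃ (k : ℕ) (c : F), x = a ^ k * c ^ p := by
  have : Fact p.Prime := ⟨hp⟩
  by_cases hx : x = 0
  · subst hx
    exact ⟨fun _ => ⟨0, 0, by simp [hp.ne_zero]⟩, fun _ => ⟨0, by simp⟩⟩
  constructor
  · rintro ⟨k, hk⟩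
    have h : powerClass p (x / a ^ k.val) = 0 := by
      rw [powerClass_div hx (pow_ne_zero _ ha), powerClass_pow, hk]; simp
    obtain ⟨c, hc⟩ := (powerClass_eq_zero_iff hp.ne_zero).1 h
    refine ⟨k.val, c, ?_⟩
    simp only at hc
    rw [hc, mul_div_cancel₀ _ (pow_ne_zero _ ha)]
  · rintro ⟨k, c, h⟩
    have hc : c ^ p ≠ 0 := by rintro hc; exact hx (by simp [h, hc])
    exact ⟨k, by rw [h, powerClass_mul (pow_ne_zero _ ha) hc, powerClass_pow, powerClass_pow_self,
      add_zero]⟩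

theorem isPRigidElement_iff (hp : p.Prime) {a : F} (ha : a ∉ pthPowers p F) :
    IsPRigidElement p a ↔ ∀ y : AdjoinRoot (X ^ p - C a : F[X]),
      ∃ k : ZMod p, powerClass p (Algebra.norm F y) = k • powerClass p a := by
  have ha0 : a ≠ 0 := by rintro rfl; exact ha ⟨0, by simp [hp.ne_zero]⟩
  simp only [IsPRigidElement, ha, not_false_eq_true, true_and, exists_powerClass_eq_smul_iff hp ha0]

end PowerClass

/-! ### Additive rigidity and barycentric weights -/

/-- The class of `1 - x` is a multiple of the class of `x`, for all `x` outside `F ^ p`. -/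
def IsAdditivelyRigid (p : ℕ) (F : Type*) [Field F] : Prop :=
  ∀ x : F, powerClass p x ≠ 0 → ∃ k : ZMod p, powerClass p (1 - x) = k • powerClass p x

section Rigid

variable {p : ℕ} [Fact p.Prime] {F : Type*} [Field F]

/-- Factor x + y = x(1 - (-y/x)), where the sign is invisible because -1 is a p-th power for odd p.
Thus [x + y] lies on the affine line through [x] and [y]. -/
theorem IsAdditivelyRigid.exists_add (hF : IsAdditivelyRigid p F) (hp : Odd p) {x y : F}
    (hx : x ≠ 0) (hy : y ≠ 0) (hxy : powerClass p x ≠ powerClass p y) :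
    x + y ≠ 0 ∧ ∃ m : ZMod p,
      powerClass p (x + y) = (1 - m) • powerClass p x + m • powerClass p y := by
  have h0 : x + y ≠ 0 := by
    intro h
    rw [eq_neg_of_add_eq_zero_left h, powerClass_neg hp] at hxy
    exact hxy rfl
  refine ⟨h0, ?_⟩
  have h1 : powerClass p (-(y / x)) = powerClass p y - powerClass p x := by
    rw [powerClass_neg hp, powerClass_div hy hx]
  obtain ⟨m, hm⟩ := hF (-(y / x)) (by rw [h1]; exact sub_ne_zero.2 hxy.symm)
  have h2 : x + y = x * (1 - -(y / x)) := by field_simp; ring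
  refine ⟨m, ?_⟩
  rw [h2, powerClass_mul hx, hm, h1]
  · module
  · intro h; rw [h, mul_zero] at h2; exact h0 h2

/-- A form of Ceva's theorem: the weights of three elements with affinely independent classes are
consistent. -/
theorem IsAdditivelyRigid.ceva (hF : IsAdditivelyRigid p F) (hp : Odd p) {x y z : F}
    (hx : x ≠ 0) (hy : y ≠ 0) (hz : z ≠ 0)
    (hind : ∀ r s t : ZMod p, r + s + t = 0 →
      r • powerClass p x + s • powerClass p y + t • powerClass p z = 0 → r = 0 ∧ s = 0 ∧ t = 0)
    {X Y Z : ZMod p} (hY : Y ≠ 0) (hZ : Z ≠ 0) (hXZ : X + Z ≠ 0) (hYZ : Y + Z ≠ 0)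
    (h1 : (X + Z) • powerClass p (x + z) = X • powerClass p x + Z • powerClass p z)
    (h2 : (Y + Z) • powerClass p (y + z) = Y • powerClass p y + Z • powerClass p z) :
    x + y ≠ 0 ∧ X + Y ≠ 0 ∧ X + Y + Z ≠ 0 ∧
      (X + Y) • powerClass p (x + y) = X • powerClass p x + Y • powerClass p y ∧
      (X + Y + Z) • powerClass p (x + y + z) =
        X • powerClass p x + Y • powerClass p y + Z • powerClass p z := by
  have ne_of : ∀ {a b c : ZMod p}, a + b + c = 0 → ¬ (a = 0 ∧ b = 0 ∧ c = 0) →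
      a • powerClass p x + b • powerClass p y + c • powerClass p z ≠ 0 :=
    fun h h' h'' => h' (hind _ _ _ h h'')
  have hxz : powerClass p x ≠ powerClass p z := fun h =>
    ne_of (a := 1) (b := 0) (c := -1) (by ring) (by simp) (by rw [h]; module)
  have hyz : powerClass p y ≠ powerClass p z := fun h =>
    ne_of (a := 0) (b := 1) (c := -1) (by ring) (by simp) (by rw [h]; module)
  have hxy : powerClass p x ≠ powerClass p y := fun h =>
    ne_of (a := 1) (b := -1) (c := 0) (by ring) (by simp) (by rw [h]; module)
  have e1 : powerClass p (x + z) =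
      (X / (X + Z)) • powerClass p x + (Z / (X + Z)) • powerClass p z := by
    rw [div_eq_inv_mul, div_eq_inv_mul, mul_smul, mul_smul, ← smul_add, ← h1, inv_smul_smul₀ hXZ]
  have e2 : powerClass p (y + z) =
      (Y / (Y + Z)) • powerClass p y + (Z / (Y + Z)) • powerClass p z := by
    rw [div_eq_inv_mul, div_eq_inv_mul, mul_smul, mul_smul, ← smul_add, ← h2, inv_smul_smul₀ hYZ]
  have s1 : X / (X + Z) + Z / (X + Z) = 1 := by field_simp
  have s2 : Y / (Y + Z) + Z / (Y + Z) = 1 := by field_simp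
  obtain ⟨hxz0, -⟩ := hF.exists_add hp hx hz hxz
  obtain ⟨hyz0, -⟩ := hF.exists_add hp hy hz hyz
  obtain ⟨hxy0, m, hm⟩ := hF.exists_add hp hx hy hxy
  -- The point [x + y + z] is placed on three cevians, with parameters s, t, r. Affine independence
  -- allows its barycentric coordinates to be compared.
  obtain ⟨-, s, hs⟩ := hF.exists_add hp hxz0 hy (fun h =>
    ne_of (a := X / (X + Z)) (b := -1) (c := Z / (X + Z)) (by linear_combination s1) (by simp)
      (by rw [← h, e1]; module))
  obtain ⟨-, t, ht⟩ := hF.exists_add hp hyz0 hx (fun h =>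
    ne_of (a := -1) (b := Y / (Y + Z)) (c := Z / (Y + Z)) (by linear_combination s2) (by simp)
      (by rw [← h, e2]; module))
  obtain ⟨-, r, hr⟩ := hF.exists_add hp hxy0 hz (fun h =>
    ne_of (a := 1 - m) (b := m) (c := -1) (by ring) (by simp) (by rw [← h, hm]; module))
  rw [show x + z + y = x + y + z by ring, e1] at hs
  rw [show y + z + x = x + y + z by ring, e2] at ht
  rw [hm] at hr
  obtain ⟨a1, a2, a3⟩ := hind ((1 - s) * (X / (X + Z)) - t) (s - (1 - t) * (Y / (Y + Z)))
    ((1 - s) * (Z / (X + Z)) - (1 - t) * (Z / (Y + Z)))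
    (by linear_combination (1 - s) * s1 - (1 - t) * s2) (by
      have := sub_eq_zero.2 (hs.symm.trans ht)
      rw [← this]; module)
  obtain ⟨b1, b2, b3⟩ := hind ((1 - s) * (X / (X + Z)) - (1 - r) * (1 - m)) (s - (1 - r) * m)
    ((1 - s) * (Z / (X + Z)) - r)
    (by linear_combination (1 - s) * s1) (by
      have := sub_eq_zero.2 (hs.symm.trans hr)
      rw [← this]; module)
  -- The common factor `l` turns out to be the inverse of the total weight X + Y + Z (`hl1`), which
  -- is why that weight cannot vanish.
  obtain ⟨l, hl⟩ : ∃ l, l = (1 - s) / (X + Z) := ⟨_, rfl⟩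
  have hs' : 1 - s = l * (X + Z) := by rw [hl]; field_simp
  have ht' : 1 - t = l * (Y + Z) := by
    have : (1 - s) / (X + Z) = (1 - t) / (Y + Z) := by
      apply mul_right_cancel₀ hZ
      linear_combination a3
    rw [hl, this]; field_simp
  have c1 : s = l * Y := by
    rw [ht', sub_eq_zero] at a2; rw [a2]; field_simp
  have hl1 : l * (X + Y + Z) = 1 := by linear_combination -hs' - c1
  have hS : X + Y + Z ≠ 0 := right_ne_zero_of_mul_eq_one hl1
  have hl0 : l ≠ 0 := left_ne_zero_of_mul_eq_one hl1
  have c2 : r = l * Z := by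
    rw [hs', sub_eq_zero] at b3; rw [← b3]; field_simp
  have c3 : 1 - r = l * (X + Y) := by linear_combination -c2 - hl1
  have c4 : m * (X + Y) = Y := by
    apply mul_left_cancel₀ hl0
    linear_combination -m * c3 + c1 - b2
  have hXY : X + Y ≠ 0 := by rintro h; rw [h, mul_zero] at c4; exact hY c4.symm
  refine ⟨hxy0, hXY, hS, ?_, ?_⟩
  · rw [hm]
    have : X = (1 - m) * (X + Y) := by linear_combination c4
    nth_rw 2 [this]
    nth_rw 3 [← c4]
    module
  · rw [hr, c3, c2]
    have e : X = (1 - m) * (X + Y) := by linear_combination c4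
    have h3 : (X + Y + Z) * l = 1 := by rw [mul_comm]; exact hl1
    have : (X + Y + Z) • ((l * (X + Y)) • ((1 - m) • powerClass p x + m • powerClass p y) +
        (l * Z) • powerClass p z) = ((X + Y + Z) * l) • (((1 - m) * (X + Y)) • powerClass p x +
        (m * (X + Y)) • powerClass p y + Z • powerClass p z) := by module
    rw [this, h3, ← e, c4, one_smul]

/-- Two elements with independent classes cannot both be in residual position. -/
theorem IsAdditivelyRigid.eq_zero_or_eq_one (hF : IsAdditivelyRigid p F) (hp : Odd p) {u y : F}
    (hind : ∀ r s : ZMod p, r • powerClass p u + s • powerClass p y = 0 → r = 0 ∧ s = 0)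
    {k n : ZMod p} (hk0 : k ≠ 0) (hk1 : k ≠ 1)
    (hk : powerClass p (1 - u) = k • powerClass p u)
    (hn : powerClass p (1 - y) = n • powerClass p y) : n = 0 ∨ n = 1 := by
  by_contra! hcon
  obtain ⟨hn0, hn1⟩ := hcon
  have hu : powerClass p u ≠ 0 := fun h => by simpa using (hind 1 0 (by simp [h])).1
  have hy : powerClass p y ≠ 0 := fun h => by simpa using (hind 0 1 (by simp [h])).2
  have hu0 := ne_zero_of_powerClass_ne_zero hu
  have hy0 := ne_zero_of_powerClass_ne_zero hy
  have hk1' : 1 - k ≠ 0 := sub_ne_zero.2 hk1.symm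
  have hn1' : 1 - n ≠ 0 := sub_ne_zero.2 hn1.symm
  -- With weight 1 placed at the element 1, `a` and `b` are the weights of -u and -y: k = a / (1 +
  -- a) and n = b / (1 + b).
  obtain ⟨a, ha⟩ : ∃ a, a = k / (1 - k) := ⟨_, rfl⟩
  obtain ⟨b, hb⟩ : ∃ b, b = n / (1 - n) := ⟨_, rfl⟩
  have ha0 : a ≠ 0 := by rw [ha]; exact div_ne_zero hk0 hk1'
  have hb0 : b ≠ 0 := by rw [hb]; exact div_ne_zero hn0 hn1'
  have ha1 : (1 + a) * (1 - k) = 1 := by rw [ha]; field_simp; ring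
  have hb1 : (1 + b) * (1 - n) = 1 := by rw [hb]; field_simp; ring
  have ha2 : (1 + a) * k = a := by linear_combination -ha1
  have hb2 : (1 + b) * n = b := by linear_combination -hb1
  have hu1 : (1 + a) • powerClass p (1 + -u) = a • powerClass p (-u) := by
    rw [← sub_eq_add_neg, hk, powerClass_neg hp, smul_smul, ha2]
  have hy1 : (1 + b) • powerClass p (1 + -y) = b • powerClass p (-y) := by
    rw [← sub_eq_add_neg, hn, powerClass_neg hp, smul_smul, hb2]
  have huy := hF.ceva hp (x := -u) (y := -y) (z := 1) (by simpa) (by simpa) one_ne_zero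
    (fun r s t h h' => by
      rw [powerClass_neg hp, powerClass_neg hp, powerClass_one, smul_zero, add_zero] at h'
      obtain ⟨rfl, rfl⟩ := hind r s h'
      simpa using h) (X := a) (Y := b) (Z := 1) hb0 one_ne_zero
    (by rw [add_comm]; exact left_ne_zero_of_mul_eq_one ha1)
    (by rw [add_comm]; exact left_ne_zero_of_mul_eq_one hb1)
    (by rw [add_comm, add_comm (-u), hu1]; simp) (by rw [add_comm, add_comm (-y), hy1]; simp)
  -- By induction 1 - iu has weight 1 + ia. Since [1 - iu] and [u] lie on one line, -y serves as the
  -- auxiliary vertex off that line.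
  have key : ∀ i : ℕ, 1 + i * -u ≠ 0 ∧ 1 + i * a ≠ 0 ∧ 1 + i * a + b ≠ 0 ∧
      (1 + i * a) • powerClass p (1 + i * -u) = (i * a) • powerClass p u ∧
      (1 + i * a + b) • powerClass p (1 + i * -u + -y) =
        (i * a) • powerClass p u + b • powerClass p y := by
    intro i
    induction i with
    | zero =>
      refine ⟨by simp, by simp, ?_, by simp, ?_⟩
      · simpa using left_ne_zero_of_mul_eq_one hb1
      · simpa [powerClass_neg hp] using hy1
    | succ i ih =>
      obtain ⟨i1, i2, i3, i4, i5⟩ := ih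
      have i4' : powerClass p (1 + i * -u) = (i * a / (1 + i * a)) • powerClass p u := by
        rw [div_eq_inv_mul, mul_smul, ← i4, inv_smul_smul₀ i2]
      have := hF.ceva hp (x := 1 + i * -u) (y := -u) (z := -y) i1 (by simpa) (by simpa)
        (fun r s t h h' => by
          rw [powerClass_neg hp, powerClass_neg hp, i4', smul_smul, ← add_smul] at h'
          obtain ⟨h1, rfl⟩ := hind _ _ h'
          have : r * (1 / (1 + i * a)) = 0 := by
            field_simp
            field_simp at h1
            linear_combination (1 + i * a) * h - h1
          have hr : r = 0 := by
            rcases mul_eq_zero.1 this with h | h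
            · exact h
            · exact absurd h (one_div_ne_zero i2)
          subst hr
          simpa using h) (X := 1 + i * a) (Y := a) (Z := b) ha0 hb0 i3 huy.2.1
        (by rw [i5, i4, powerClass_neg hp])
        (by rw [huy.2.2.2.1])
      obtain ⟨j1, j2, j3, j4, j5⟩ := this
      rw [i4] at j4 j5
      rw [powerClass_neg hp] at j4 j5
      rw [powerClass_neg hp] at j5
      have e1 : 1 + ((i + 1 : ℕ) : F) * -u = 1 + i * -u + -u := by push_cast; ring
      have e2 : 1 + ((i + 1 : ℕ) : ZMod p) * a = 1 + i * a + a := by push_cast; ring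
      have e3 : ((i + 1 : ℕ) : ZMod p) * a = i * a + a := by push_cast; ring
      rw [e1, e2, e3]
      refine ⟨j1, j2, j3, ?_, ?_⟩
      · rw [j4, add_smul]
      · rw [j5, add_smul]
  -- For i congruent to -1/a modulo p the weight 1 + ia vanishes, contradicting `key`.
  have := (key (-a⁻¹ : ZMod p).val).2.1
  rw [ZMod.natCast_val, ZMod.cast_id] at this
  exact this (by field_simp; ring)

end Rigid

/-! ### The valuation ring attached to small elements -/

section Valuation

variable {p : ℕ} {F : Type*} [Field F]

/-- The elements with class outside `H` that are small, in the sense that `1 - x` is a `p`-th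
power. -/
def IsSmall (p : ℕ) {F : Type*} [Field F] (H : Submodule (ZMod p) (PowerClassGroup p F)) (x : F) :
    Prop :=
  powerClass p x ∉ H ∧ powerClass p (1 - x) = 0

/-- Outside `H` an element or its inverse is small. -/
def HasDichotomy (p : ℕ) {F : Type*} [Field F]
    (H : Submodule (ZMod p) (PowerClassGroup p F)) : Prop :=
  ∀ x : F, powerClass p x ∉ H → powerClass p (1 - x) = 0 ∨ powerClass p (1 - x) = powerClass p x

variable {H : Submodule (ZMod p) (PowerClassGroup p F)}

theorem add_self_mem_iff [Fact p.Prime] (hp : Odd p) {v : PowerClassGroup p F} :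
    v + v ∈ H ↔ v ∈ H := by
  have h2 : (2 : ZMod p) ≠ 0 := by
    have := (ZMod.natCast_eq_zero_iff 2 p).not.2 fun h => by
      have := (Nat.prime_dvd_prime_iff_eq Fact.out Nat.prime_two).1 h
      subst this
      exact absurd hp (by decide)
    simpa using this
  rw [← two_smul (ZMod p), H.smul_mem_iff h2]

theorem ne_zero_of_powerClass_notMem {x : F} (h : powerClass p x ∉ H) : x ≠ 0 := by
  rintro rfl
  exact h (by simp)

theorem powerClass_ne_zero_of_notMem {x : F} (h : powerClass p x ∉ H) : powerClass p x ≠ 0 := by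
  intro h'
  exact h (by simp [h'])

theorem one_sub_ne_zero_of_powerClass_ne_zero {x : F} (h : powerClass p x ≠ 0) : 1 - x ≠ 0 := by
  intro h'
  rw [← sub_eq_zero.1 h'] at h
  simp at h

theorem powerClass_one_sub_inv (hp : Odd p) {x : F} (h : powerClass p x ≠ 0) :
    powerClass p (1 - x⁻¹) = powerClass p (1 - x) - powerClass p x := by
  have hx := ne_zero_of_powerClass_ne_zero h
  have h1 := one_sub_ne_zero_of_powerClass_ne_zero h
  rw [← powerClass_div h1 hx, ← powerClass_neg hp]
  congr 1
  field_simp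
  ring

theorem IsSmall.ne_zero {x : F} (h : IsSmall p H x) : x ≠ 0 := ne_zero_of_powerClass_notMem h.1

theorem IsSmall.one_sub_ne_zero {x : F} (h : IsSmall p H x) : 1 - x ≠ 0 :=
  one_sub_ne_zero_of_powerClass_ne_zero (powerClass_ne_zero_of_notMem h.1)

theorem IsSmall.not_inv (hp : Odd p) {x : F} (h : IsSmall p H x) : ¬ IsSmall p H x⁻¹ := by
  rintro ⟨-, h'⟩
  have hx := powerClass_ne_zero_of_notMem h.1
  rw [powerClass_one_sub_inv hp hx, h.2, zero_sub, neg_eq_zero] at h'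
  exact hx h'

namespace HasDichotomy

/-- Since [1 - x⁻¹] = [1 - x] - [x], inversion exchanges the two alternatives of the dichotomy. -/
theorem isSmall_or_inv (hN : HasDichotomy p H) (hp : Odd p) {x : F} (h : powerClass p x ∉ H) :
    IsSmall p H x ∨ IsSmall p H x⁻¹ := by
  have hx := powerClass_ne_zero_of_notMem h
  rcases hN x h with h1 | h1
  · exact Or.inl ⟨h, h1⟩
  · refine Or.inr ⟨?_, ?_⟩
    · rwa [powerClass_inv, neg_mem_iff]
    · rw [powerClass_one_sub_inv hp hx, h1, sub_self]

/-- Write 1 - xy = (1 - x)(1 - q) with [q] = [x]. Then [1 - xy] is 0 or [x], and also 0 or [xy]; it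
is 0 because [y] ≠ 0. -/
theorem mul (hN : HasDichotomy p H) (hp : Odd p) {x y : F} (hx : IsSmall p H x)
    (hy : IsSmall p H y) (hxy : powerClass p (x * y) ∉ H) : IsSmall p H (x * y) := by
  refine ⟨hxy, ?_⟩
  have hx0 := hx.ne_zero
  have hx1 := hx.one_sub_ne_zero
  have hy1 := hy.one_sub_ne_zero
  have hxy1 := one_sub_ne_zero_of_powerClass_ne_zero (powerClass_ne_zero_of_notMem hxy)
  have hq : powerClass p (-(x * (1 - y) / (1 - x))) = powerClass p x := by
    rw [powerClass_neg hp, powerClass_div (mul_ne_zero hx0 hy1) hx1, powerClass_mul hx0 hy1, hx.2,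
      hy.2, add_zero, sub_zero]
  have e : 1 - x * y = (1 - x) * (1 - -(x * (1 - y) / (1 - x))) := by field_simp; ring
  have h2 : powerClass p (1 - x * y) = powerClass p (1 - -(x * (1 - y) / (1 - x))) := by
    rw [e, powerClass_mul hx1, hx.2, zero_add]
    intro h; rw [h, mul_zero] at e; exact hxy1 e
  rcases hN _ (hq ▸ hx.1) with h | h
  · rw [h2, h]
  · rcases hN _ hxy with h' | h'
    · exact h'
    · rw [h2, h, hq, powerClass_mul hx0 hy.ne_zero, left_eq_add] at h'
      exact absurd h' (powerClass_ne_zero_of_notMem hy.1)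

/-- Otherwise -x⁻¹ is small, and squaring makes both x² and its inverse small. Squares remain
outside H because 2 is invertible modulo p. -/
theorem neg [Fact p.Prime] (hN : HasDichotomy p H) (hp : Odd p) {x : F} (hx : IsSmall p H x) :
    IsSmall p H (-x) := by
  have h0 : powerClass p (-x) ∉ H := by rw [powerClass_neg hp]; exact hx.1
  rcases hN.isSmall_or_inv hp h0 with h | h
  · exact h
  have hsq : powerClass p (x * x) ∉ H := by
    rw [powerClass_mul hx.ne_zero hx.ne_zero]
    exact fun h => hx.1 ((add_self_mem_iff hp).1 h)
  have h1 := hN.mul hp hx hx hsq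
  have h3 := hN.mul hp h h (by
    rw [show (-x)⁻¹ * (-x)⁻¹ = (x * x)⁻¹ by field_simp, powerClass_inv, neg_mem_iff]
    exact hsq)
  rw [show (-x)⁻¹ * (-x)⁻¹ = (x * x)⁻¹ by have := hx.ne_zero; field_simp] at h3
  exact absurd h3 (h1.not_inv hp)

end HasDichotomy

/-- The conditions under which the small elements determine a valuation ring. -/
structure IsValuationDatum (p : ℕ) {F : Type*} [Field F]
    (H : Submodule (ZMod p) (PowerClassGroup p F)) : Prop where
  dichotomy : HasDichotomy p H
  one_sub_mul : ∀ x y : F, IsSmall p H x → IsSmall p H y → powerClass p (1 - (1 - x) * y) = 0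
  one_sub_mem : ∀ x : F, powerClass p x ∈ H → powerClass p x ≠ 0 → powerClass p (1 - x) ∈ H

/-- The elements with class in `H` that preserve smallness. -/
def PreservesSmall (p : ℕ) {F : Type*} [Field F]
    (H : Submodule (ZMod p) (PowerClassGroup p F)) (h : F) : Prop :=
  powerClass p h ∈ H ∧ h ≠ 0 ∧ ∀ y, IsSmall p H y → IsSmall p H (h * y)

theorem mul_notMem_of_mem {h x : F} (h0 : h ≠ 0) (hh : powerClass p h ∈ H)
    (hx : powerClass p x ∉ H) : powerClass p (h * x) ∉ H := by
  rw [powerClass_mul h0 (ne_zero_of_powerClass_notMem hx)]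
  exact fun h' => hx ((Submodule.add_mem_iff_right H hh).1 h')

/-- The candidate for the valuation ring. -/
def IsIntegralFor (p : ℕ) {F : Type*} [Field F]
    (H : Submodule (ZMod p) (PowerClassGroup p F)) (x : F) : Prop :=
  x = 0 ∨ IsSmall p H x ∨ PreservesSmall p H x

theorem PreservesSmall.mul {x y : F} (hx : PreservesSmall p H x) (hy : PreservesSmall p H y) :
    PreservesSmall p H (x * y) := by
  refine ⟨?_, mul_ne_zero hx.2.1 hy.2.1, fun z hz => ?_⟩
  · rw [powerClass_mul hx.2.1 hy.2.1]; exact H.add_mem hx.1 hy.1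
  · rw [mul_assoc]; exact hx.2.2 _ (hy.2.2 _ hz)

namespace IsValuationDatum

theorem preservesSmall_one_sub (hH : IsValuationDatum p H)
    {x : F} (hx : IsSmall p H x) : PreservesSmall p H (1 - x) := by
  refine ⟨by rw [hx.2]; exact H.zero_mem, hx.one_sub_ne_zero, fun y hy => ⟨?_, ?_⟩⟩
  · exact mul_notMem_of_mem hx.one_sub_ne_zero (by rw [hx.2]; exact H.zero_mem) hy.1
  · exact hH.one_sub_mul x y hx hy

theorem preservesSmall_inv_one_sub (hH : IsValuationDatum p H) (hp : Odd p)
    {x : F} (hx : IsSmall p H x) :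
    PreservesSmall p H (1 - x)⁻¹ := by
  have h1 := hx.one_sub_ne_zero
  have e : (1 - x)⁻¹ = 1 - -(x / (1 - x)) := by field_simp; ring
  rw [e]
  refine hH.preservesSmall_one_sub ⟨?_, ?_⟩
  · rw [powerClass_neg hp, powerClass_div hx.ne_zero h1, hx.2, sub_zero]
    exact hx.1
  · rw [← e, powerClass_inv, hx.2, neg_zero]

/-- For small z, the classes of xz and yz cannot both lie in H, since 2[x] would too. So xyz can be
bracketed with every partial product outside H. -/
theorem mul_preservesSmall [Fact p.Prime] (hH : IsValuationDatum p H) (hp : Odd p)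
    {x y : F} (hx : IsSmall p H x) (hy : IsSmall p H y)
    (hxy : powerClass p (x * y) ∈ H) : PreservesSmall p H (x * y) := by
  have hx0 := hx.ne_zero
  have hy0 := hy.ne_zero
  refine ⟨hxy, mul_ne_zero hx0 hy0, fun z hz => ?_⟩
  have hz0 := hz.ne_zero
  have hxyz : powerClass p (x * y * z) ∉ H := mul_notMem_of_mem (mul_ne_zero hx0 hy0) hxy hz.1
  by_cases h1 : powerClass p (y * z) ∈ H
  · by_cases h2 : powerClass p (x * z) ∈ H
    · exfalso
      rw [powerClass_mul hx0 hy0] at hxy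
      rw [powerClass_mul hy0 hz0] at h1
      rw [powerClass_mul hx0 hz0] at h2
      have h3 : powerClass p x + powerClass p x ∈ H := by
        have := H.sub_mem (H.add_mem hxy h2) h1
        convert this using 1
        abel
      exact hx.1 ((add_self_mem_iff hp).1 h3)
    · have := hH.dichotomy.mul hp hy (hH.dichotomy.mul hp hx hz h2)
        (by rwa [show y * (x * z) = x * y * z by ring])
      rwa [show y * (x * z) = x * y * z by ring] at this
  · have := hH.dichotomy.mul hp hx (hH.dichotomy.mul hp hy hz h1) (by rwa [← mul_assoc])
    rwa [← mul_assoc] at this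

theorem isIntegralFor_mul [Fact p.Prime] (hH : IsValuationDatum p H) (hp : Odd p)
    {x y : F} (hx : IsIntegralFor p H x) (hy : IsIntegralFor p H y) :
    IsIntegralFor p H (x * y) := by
  rcases hx with rfl | hx | hx
  · exact Or.inl (zero_mul y)
  · rcases hy with rfl | hy | hy
    · exact Or.inl (mul_zero x)
    · by_cases hxy : powerClass p (x * y) ∈ H
      · exact Or.inr (Or.inr (hH.mul_preservesSmall hp hx hy hxy))
      · exact Or.inr (Or.inl (hH.dichotomy.mul hp hx hy hxy))
    · rw [mul_comm]; exact Or.inr (Or.inl (hy.2.2 x hx))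
  · rcases hy with rfl | hy | hy
    · exact Or.inl (mul_zero x)
    · exact Or.inr (Or.inl (hx.2.2 y hy))
    · exact Or.inr (Or.inr (hx.mul hy))

theorem isIntegralFor_neg [Fact p.Prime] (hH : IsValuationDatum p H) (hp : Odd p)
    {x : F} (hx : IsIntegralFor p H x) : IsIntegralFor p H (-x) := by
  rcases hx with rfl | hx | hx
  · exact Or.inl neg_zero
  · exact Or.inr (Or.inl (hH.dichotomy.neg hp hx))
  · refine Or.inr (Or.inr ⟨by rw [powerClass_neg hp]; exact hx.1, neg_ne_zero.2 hx.2.1,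
      fun y hy => ?_⟩)
    rw [neg_mul]
    exact hH.dichotomy.neg hp (hx.2.2 y hy)

theorem _root_.exists_of_not_preservesSmall (hN : HasDichotomy p H) (hp : Odd p) {h : F}
    (h0 : h ≠ 0) (hh : powerClass p h ∈ H) (h' : ¬ PreservesSmall p H h) :
    ∃ y, IsSmall p H y ∧ IsSmall p H (h * y)⁻¹ := by
  simp only [PreservesSmall, hh, h0, ne_eq, not_false_eq_true, true_and, not_forall] at h'
  obtain ⟨y, hy, hy'⟩ := h'
  exact ⟨y, hy, (hN.isSmall_or_inv hp (mul_notMem_of_mem h0 hh hy.1)).resolve_left hy'⟩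

theorem preservesSmall_or_inv [Fact p.Prime] (hH : IsValuationDatum p H) (hp : Odd p)
    {h : F} (h0 : h ≠ 0) (hh : powerClass p h ∈ H) :
    PreservesSmall p H h ∨ PreservesSmall p H h⁻¹ := by
  by_contra! hcon
  obtain ⟨x, hx, hx'⟩ := exists_of_not_preservesSmall hH.dichotomy hp h0 hh hcon.1
  obtain ⟨y, hy, hy'⟩ := exists_of_not_preservesSmall hH.dichotomy hp (inv_ne_zero h0)
    (by rwa [powerClass_inv, neg_mem_iff]) hcon.2
  have hx0 := hx.ne_zero
  have hy0 := hy.ne_zero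
  -- Suitable products of x, y, (hx)⁻¹ and (h⁻¹y)⁻¹ cancel h and make an element and its inverse
  -- both small. If [xy] is in H, the element is y and the route passes through hx/y; otherwise it
  -- is xy.
  by_cases hxy : powerClass p (x * y) ∈ H
  · have e1 : (h⁻¹ * y)⁻¹ * x = h * (x * y⁻¹) := by field_simp
    have e2 : (h * x)⁻¹ * (h * (x * y⁻¹)) = y⁻¹ := by field_simp
    have h1 : powerClass p (x * y⁻¹) ∉ H := by
      intro h1
      rw [powerClass_mul hx0 hy0] at hxy
      rw [powerClass_mul hx0 (inv_ne_zero hy0), powerClass_inv] at h1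
      have h2 := H.add_mem hxy h1
      rw [add_add_add_comm, add_neg_cancel, add_zero] at h2
      exact hx.1 ((add_self_mem_iff hp).1 h2)
    have h2 := hH.dichotomy.mul hp hy' hx (by rw [e1]; exact mul_notMem_of_mem h0 hh h1)
    rw [e1] at h2
    have h3 := hH.dichotomy.mul hp hx' h2 (by
      rw [e2, powerClass_inv, neg_mem_iff]; exact hy.1)
    rw [e2] at h3
    exact hy.not_inv hp h3
  · have e : (h * x)⁻¹ * (h⁻¹ * y)⁻¹ = (x * y)⁻¹ := by field_simp
    have h1 := hH.dichotomy.mul hp hx hy hxy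
    have h2 := hH.dichotomy.mul hp hx' hy' (by rw [e, powerClass_inv, neg_mem_iff]; exact hxy)
    rw [e] at h2
    exact h1.not_inv hp h2

/-- This is the heart of closure under addition. If x preserves smallness and y is small, then 1 -
(1 - x)y is the product of 1 - y and 1 + (1 - y)⁻¹xy. If [1 - x] is outside H, then `one_sub_mem`
forces [x] = 0, so 1 - x is itself small. -/
theorem isIntegralFor_one_sub [Fact p.Prime] (hH : IsValuationDatum p H) (hp : Odd p)
    {x : F} (hx : IsIntegralFor p H x) :
    IsIntegralFor p H (1 - x) := by
  rcases hx with rfl | hx | hx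
  · rw [sub_zero]
    exact Or.inr (Or.inr ⟨by simp, one_ne_zero, fun y hy => by rwa [one_mul]⟩)
  · exact Or.inr (Or.inr (hH.preservesSmall_one_sub hx))
  · by_cases h1 : 1 - x = 0
    · exact Or.inl h1
    by_cases h2 : powerClass p (1 - x) ∈ H
    · refine Or.inr (Or.inr ⟨h2, h1, fun y hy => ?_⟩)
      have h3 := mul_notMem_of_mem h1 h2 hy.1
      refine ⟨h3, ?_⟩
      have h4 := hH.dichotomy.neg hp
        ((hH.preservesSmall_inv_one_sub hp hy).2.2 _ (hx.2.2 y hy))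
      have hy1 := hy.one_sub_ne_zero
      have e : 1 - (1 - x) * y = (1 - y) * (1 - -((1 - y)⁻¹ * (x * y))) := by field_simp; ring
      rw [e, powerClass_mul hy1 h4.one_sub_ne_zero, hy.2, h4.2, add_zero]
    · refine Or.inr (Or.inl ⟨h2, ?_⟩)
      rw [sub_sub_cancel]
      by_contra h3
      exact h2 (hH.one_sub_mem x hx.1 h3)

theorem isIntegralFor_or_inv [Fact p.Prime] (hH : IsValuationDatum p H) (hp : Odd p)
    (x : F) : IsIntegralFor p H x ∨ IsIntegralFor p H x⁻¹ := by
  by_cases h0 : x = 0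
  · exact Or.inl (Or.inl h0)
  by_cases h : powerClass p x ∈ H
  · exact (hH.preservesSmall_or_inv hp h0 h).imp (fun h => Or.inr (Or.inr h))
      fun h => Or.inr (Or.inr h)
  · exact (hH.dichotomy.isSmall_or_inv hp h).imp (fun h => Or.inr (Or.inl h))
      fun h => Or.inr (Or.inl h)

theorem isIntegralFor_add [Fact p.Prime] (hH : IsValuationDatum p H) (hp : Odd p)
    {x y : F} (hx : IsIntegralFor p H x) (hy : IsIntegralFor p H y) :
    IsIntegralFor p H (x + y) := by
  have key : ∀ x y : F, x ≠ 0 → IsIntegralFor p H x → IsIntegralFor p H (y * x⁻¹) →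
      IsIntegralFor p H (x + y) := by
    intro x y h0 hx h
    have := hH.isIntegralFor_mul hp hx
      (hH.isIntegralFor_one_sub hp (hH.isIntegralFor_neg hp h))
    convert this using 1
    field_simp
    ring
  by_cases hx0 : x = 0
  · rwa [hx0, zero_add]
  by_cases hy0 : y = 0
  · rwa [hy0, add_zero]
  rcases hH.isIntegralFor_or_inv hp (y * x⁻¹) with h | h
  · exact key x y hx0 hx h
  · rw [add_comm]
    exact key y x hy0 hy (by rwa [mul_inv_rev, inv_inv] at h)

/-- The valuation ring determined by the small elements. -/
def valuationSubring [Fact p.Prime] (hH : IsValuationDatum p H) (hp : Odd p)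
    : ValuationSubring F where
  carrier := {x | IsIntegralFor p H x}
  mul_mem' := hH.isIntegralFor_mul hp
  one_mem' := by simpa using hH.isIntegralFor_one_sub hp (x := 0) (Or.inl rfl)
  add_mem' := hH.isIntegralFor_add hp
  zero_mem' := Or.inl rfl
  neg_mem' := hH.isIntegralFor_neg hp
  mem_or_inv_mem' := hH.isIntegralFor_or_inv hp

theorem not_isIntegralFor_inv (hp : Odd p)
    {x : F} (hx : IsSmall p H x) : ¬ IsIntegralFor p H x⁻¹ := by
  rintro (h | h | h)
  · exact hx.ne_zero (inv_eq_zero.1 h)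
  · exact hx.not_inv hp h
  · have := h.1
    rw [powerClass_inv, neg_mem_iff] at this
    exact hx.1 this

/-- A nonunit x with class in H has an inverse that does not preserve smallness, hence x = yz with y
and z small. Then 1 - yz is the product of 1 - y and 1 + (1 - y)⁻¹(1 - z)y. -/
theorem powerClass_one_sub_of_valuation_lt_one [Fact p.Prime] (hH : IsValuationDatum p H) (hp : Odd p)
    {x : F}
    (hx : (hH.valuationSubring hp).valuation x < 1) : powerClass p (1 - x) = 0 := by
  by_cases h0 : x = 0
  · simp [h0]
  rw [← ValuationSubring.mem_nonunits_iff, ValuationSubring.mem_nonunits_iff_or] at hx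
  have hx' : ¬ IsIntegralFor p H x⁻¹ := hx.resolve_left h0
  rcases (hH.isIntegralFor_or_inv hp x).resolve_right hx' with h | h | h
  · exact absurd h h0
  · exact h.2
  · obtain ⟨y, hy, hy'⟩ := exists_of_not_preservesSmall hH.dichotomy hp (inv_ne_zero h0)
      (by rw [powerClass_inv, neg_mem_iff]; exact h.1) fun h => hx' (Or.inr (Or.inr h))
    obtain ⟨z, hz⟩ : ∃ z, z = (x⁻¹ * y)⁻¹ := ⟨_, rfl⟩
    have hx : x = y * z := by have := hy.ne_zero; rw [hz]; field_simp
    rw [← hz] at hy'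
    have hy1 := hy.one_sub_ne_zero
    have h4 := hH.dichotomy.neg hp ((hH.preservesSmall_inv_one_sub hp hy).2.2 _
      ((hH.preservesSmall_one_sub hy').2.2 y hy))
    have e : 1 - x = (1 - y) * (1 - -((1 - y)⁻¹ * ((1 - z) * y))) := by
      rw [hx]; field_simp; ring
    rw [e, powerClass_mul hy1 h4.one_sub_ne_zero, hy.2, h4.2, add_zero]

theorem powerClass_mem_of_valuation_eq_one [Fact p.Prime] (hH : IsValuationDatum p H) (hp : Odd p)
    {x : F}
    (hx : (hH.valuationSubring hp).valuation x = 1) : powerClass p x ∈ H := by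
  by_contra h
  have h1 : x ∈ hH.valuationSubring hp := by
    rw [← ValuationSubring.valuation_le_one_iff, hx]
  have h2 : x⁻¹ ∈ hH.valuationSubring hp := by
    rw [← ValuationSubring.valuation_le_one_iff, map_inv₀, hx, inv_one]
  rcases hH.dichotomy.isSmall_or_inv hp h with h' | h'
  · exact not_isIntegralFor_inv hp h' h2
  · exact not_isIntegralFor_inv hp h' (by rwa [inv_inv])

end IsValuationDatum

end Valuation

/-! ### Choosing the line H -/

section Existence

variable {p : ℕ} {F : Type*} [Field F] {H : Submodule (ZMod p) (PowerClassGroup p F)}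

/-- Otherwise the dichotomy gives [(1 - y) + xy] = [y]. Additive rigidity puts this class on the
line of [xy], and the dichotomy for xy excludes the remaining possibilities. -/
theorem IsSmall.powerClass_one_sub_mul [Fact p.Prime] (hF : IsAdditivelyRigid p F) (hp : Odd p)
    (hN : HasDichotomy p H) {x y : F} (hx : IsSmall p H x) (hy : IsSmall p H y)
    (hxy : powerClass p (x * y) ≠ 0) : powerClass p (1 - (1 - x) * y) = 0 := by
  have hx1 := hx.one_sub_ne_zero
  have hy1 := hy.one_sub_ne_zero
  have h1 : powerClass p ((1 - x) * y) = powerClass p y := by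
    rw [powerClass_mul hx1 hy.ne_zero, hx.2, zero_add]
  rcases hN _ (by rw [h1]; exact hy.1) with h | h
  · exact h
  exfalso
  rw [h1] at h
  obtain ⟨-, m, hm⟩ := hF.exists_add hp hy1 (mul_ne_zero hx.ne_zero hy.ne_zero)
    (by rw [hy.2]; exact hxy.symm)
  rw [show 1 - y + x * y = 1 - (1 - x) * y by ring, h, hy.2, smul_zero, zero_add] at hm
  by_cases hxy' : powerClass p (x * y) ∈ H
  · exact hy.1 (hm ▸ H.smul_mem m hxy')
  · have h2 : powerClass p (-(x * y / (1 - y))) = powerClass p (x * y) := by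
      rw [powerClass_neg hp, powerClass_div (mul_ne_zero hx.ne_zero hy.ne_zero) hy1, hy.2, sub_zero]
    have e : 1 - (1 - x) * y = (1 - y) * (1 - -(x * y / (1 - y))) := by field_simp; ring
    have h0 : 1 - -(x * y / (1 - y)) ≠ 0 :=
      one_sub_ne_zero_of_powerClass_ne_zero (by rw [h2]; exact hxy)
    rw [e, powerClass_mul hy1 h0, hy.2, zero_add] at h
    rcases hN _ (by rw [h2]; exact hxy') with h3 | h3
    · rw [h3] at h
      exact powerClass_ne_zero_of_notMem hy.1 h.symm
    · rw [h3, h2, powerClass_mul hx.ne_zero hy.ne_zero, add_eq_right] at h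
      exact powerClass_ne_zero_of_notMem hx.1 h

/-- In 1 - uy = (1 - u) + u(1 - y) the summands have distinct classes k[u] and [u] in H. Hence [1 -
uy] is in H and cannot equal [uy]. -/
theorem IsSmall.smul_of_residual [Fact p.Prime] (hF : IsAdditivelyRigid p F) (hp : Odd p)
    (hN : HasDichotomy p H) {u : F} (hu : powerClass p u ∈ H) (hu0 : powerClass p u ≠ 0)
    {k : ZMod p} (hk1 : k ≠ 1) (hk : powerClass p (1 - u) = k • powerClass p u)
    {y : F} (hy : IsSmall p H y) : IsSmall p H (u * y) := by
  have hu' := ne_zero_of_powerClass_ne_zero hu0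
  have h0 : powerClass p (u * y) ∉ H := mul_notMem_of_mem hu' hu hy.1
  refine ⟨h0, (hN _ h0).resolve_right fun h => h0 ?_⟩
  have hu1 := one_sub_ne_zero_of_powerClass_ne_zero hu0
  have hy1 := hy.one_sub_ne_zero
  have h2 : powerClass p (u * (1 - y)) = powerClass p u := by
    rw [powerClass_mul hu' hy1, hy.2, add_zero]
  obtain ⟨-, m, hm⟩ := hF.exists_add hp hu1 (mul_ne_zero hu' hy1) (by
    rw [h2, hk]
    intro h
    have : (k - 1) • powerClass p u = 0 := by rw [sub_smul, h, one_smul, sub_self]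
    rcases smul_eq_zero.1 this with h | h
    · exact hk1 (sub_eq_zero.1 h)
    · exact hu0 h)
  rw [← h, show 1 - u * y = 1 - u + u * (1 - y) by ring, hm, h2, hk]
  exact H.add_mem (H.smul_mem _ (H.smul_mem _ hu)) (H.smul_mem _ hu)

theorem independent_of_notMem_span [Fact p.Prime] {v w : PowerClassGroup p F} (hv : v ≠ 0)
    (hw : w ∉ Submodule.span (ZMod p) {v}) (r s : ZMod p) (h : r • v + s • w = 0) :
    r = 0 ∧ s = 0 := by
  have hs : s = 0 := by
    by_contra hs
    refine hw (Submodule.mem_span_singleton.2 ⟨-(s⁻¹ * r), ?_⟩)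
    have : s • w = -(r • v) := by rw [eq_neg_iff_add_eq_zero, add_comm]; exact h
    rw [neg_smul, mul_smul, ← smul_neg, ← this, inv_smul_smul₀ hs]
  subst hs
  rw [zero_smul, add_zero, smul_eq_zero] at h
  exact ⟨h.resolve_right hv, rfl⟩

theorem isValuationDatum_span_of_residual [Fact p.Prime] (hF : IsAdditivelyRigid p F)
    (hp : Odd p) {u : F} (hu : powerClass p u ≠ 0) {k : ZMod p} (hk0 : k ≠ 0) (hk1 : k ≠ 1)
    (hk : powerClass p (1 - u) = k • powerClass p u) :
    IsValuationDatum p (Submodule.span (ZMod p) {powerClass p u}) := by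
  have hmem := Submodule.mem_span_singleton_self (R := ZMod p) (powerClass p u)
  have hu0 := ne_zero_of_powerClass_ne_zero hu
  have hN : HasDichotomy p (Submodule.span (ZMod p) {powerClass p u}) := by
    intro x hx
    obtain ⟨n, hn⟩ := hF x (powerClass_ne_zero_of_notMem hx)
    rcases hF.eq_zero_or_eq_one hp (independent_of_notMem_span hu hx) hk0 hk1 hk hn with rfl | rfl
    · left; rw [hn, zero_smul]
    · right; rw [hn, one_smul]
  refine ⟨hN, fun x y hx hy => ?_, fun x hx hx0 => ?_⟩
  -- The missing case [xy] = 0 is reached by replacing y with uy and then dividing u out. The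
  -- coefficient of u⁻¹ is 1 - k, which differs from 1 because k ≠ 0.
  · by_cases hxy : powerClass p (x * y) = 0
    · have h1 := hy.smul_of_residual hF hp hN hmem hu hk1 hk
      have h2 : powerClass p (x * (u * y)) ≠ 0 := by
        rw [show x * (u * y) = u * (x * y) by ring,
          powerClass_mul hu0 (mul_ne_zero hx.ne_zero hy.ne_zero), hxy, add_zero]
        exact hu
      have h3 := hx.powerClass_one_sub_mul hF hp hN h1 h2
      have h4 : IsSmall p (Submodule.span (ZMod p) {powerClass p u}) ((1 - x) * (u * y)) :=
        ⟨mul_notMem_of_mem hx.one_sub_ne_zero (by rw [hx.2]; exact Submodule.zero_mem _) h1.1, h3⟩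
      have h5 := h4.smul_of_residual hF hp hN (u := u⁻¹) (k := 1 - k)
        (by rwa [powerClass_inv, neg_mem_iff]) (by rwa [powerClass_inv, neg_ne_zero])
        (by intro h; apply hk0; linear_combination -h)
        (by rw [powerClass_one_sub_inv hp hu, hk, powerClass_inv]; module)
      rw [show u⁻¹ * ((1 - x) * (u * y)) = (1 - x) * y by field_simp] at h5
      exact h5.2
    · exact hx.powerClass_one_sub_mul hF hp hN hy hxy
  · obtain ⟨n, hn⟩ := hF x hx0
    rw [hn]
    exact Submodule.smul_mem _ _ hx

/-- If `(1 - x) * y` is not small although `x` and `y` are, then every other small element is much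
smaller than `x`. -/
theorem IsSmall.div_of_exceptional [Fact p.Prime] (hF : IsAdditivelyRigid p F) (hp : Odd p)
    (hN : HasDichotomy p (⊥ : Submodule (ZMod p) (PowerClassGroup p F))) {x y z : F}
    (hx : IsSmall p ⊥ x) (hy : IsSmall p ⊥ y) (hxy : powerClass p (1 - (1 - x) * y) ≠ 0)
    (hz : IsSmall p ⊥ z) (hzx : powerClass p z ∉ Submodule.span (ZMod p) {powerClass p x}) :
    IsSmall p (⊥ : Submodule (ZMod p) (PowerClassGroup p F)) (z / x) := by
  have hx0 := hx.ne_zero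
  have hy0 := hy.ne_zero
  have hz0 := hz.ne_zero
  have hy' : powerClass p y = -powerClass p x := by
    by_contra h
    refine hxy (hx.powerClass_one_sub_mul hF hp hN hy ?_)
    rw [powerClass_mul hx0 hy0]
    intro h'
    exact h (neg_eq_of_add_eq_zero_right h').symm
  have hzx' : powerClass p z ≠ powerClass p x := fun h =>
    hzx (h ▸ Submodule.mem_span_singleton_self _)
  have hd : powerClass p (z / x) ∉ (⊥ : Submodule (ZMod p) (PowerClassGroup p F)) := by
    rw [powerClass_div hz0 hx0, Submodule.mem_bot, sub_eq_zero]
    exact hzx'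
  -- If x/z were small, then w = (x - z)/(1 - z) would be small with [w] = [z], and 1 - x = (1 -
  -- z)(1 - w). As [zy] ≠ 0, multiplying y by 1 - w and then by 1 - z keeps it small, against `hxy`.
  refine (hN.isSmall_or_inv hp hd).resolve_right fun h => hxy ?_
  rw [inv_div] at h
  have hz1 := hz.one_sub_ne_zero
  have hxz : x - z = -(z * (1 - x / z)) := by field_simp; ring
  have hw : powerClass p ((x - z) / (1 - z)) = powerClass p z := by
    have h1 : powerClass p (x - z) = powerClass p z := by
      rw [hxz, powerClass_neg hp, powerClass_mul hz0 h.one_sub_ne_zero, h.2, add_zero]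
    rw [powerClass_div (ne_zero_of_powerClass_notMem (h1.symm ▸ hz.1)) hz1, h1, hz.2, sub_zero]
  have hw0 := ne_zero_of_powerClass_notMem (hw.symm ▸ hz.1)
  have e1 : 1 - (x - z) / (1 - z) = (1 - x) / (1 - z) := by field_simp; ring
  have hws : IsSmall p ⊥ ((x - z) / (1 - z)) :=
    ⟨hw.symm ▸ hz.1, by rw [e1, powerClass_div hx.one_sub_ne_zero hz1, hx.2, hz.2, sub_zero]⟩
  have hne : ∀ t : F, t ≠ 0 → powerClass p t = powerClass p y → powerClass p (z * t) ≠ 0 := by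
    intro t ht h
    rw [powerClass_mul hz0 ht, h, hy', ← sub_eq_add_neg, sub_ne_zero]
    exact hzx'
  have h2 := hws.powerClass_one_sub_mul hF hp hN hy (by
    rw [powerClass_mul hw0 hy0, hw, ← powerClass_mul hz0 hy0]
    exact hne y hy0 rfl)
  have h3 : powerClass p ((1 - (x - z) / (1 - z)) * y) = powerClass p y := by
    rw [powerClass_mul hws.one_sub_ne_zero hy0, hws.2, zero_add]
  have h4 := hz.powerClass_one_sub_mul hF hp hN (y := (1 - (x - z) / (1 - z)) * y)
    ⟨h3.symm ▸ hy.1, h2⟩ (hne _ (mul_ne_zero hws.one_sub_ne_zero hy0) h3)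
  rw [e1] at h4
  rwa [show (1 - z) * ((1 - x) / (1 - z) * y) = (1 - x) * y by field_simp] at h4

theorem IsSmall.bot {x : F} (hx : IsSmall p H x) :
    IsSmall p (⊥ : Submodule (ZMod p) (PowerClassGroup p F)) x :=
  ⟨fun h => hx.1 (by rw [(Submodule.mem_bot _).1 h]; exact H.zero_mem), hx.2⟩

theorem IsAdditivelyRigid.exists_isValuationDatum [Fact p.Prime] (hF : IsAdditivelyRigid p F)
    (hp : Odd p) : ∃ v : PowerClassGroup p F,
      IsValuationDatum p (Submodule.span (ZMod p) {v}) := by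
  by_cases hmed : ∃ u : F, powerClass p u ≠ 0 ∧ ∃ k : ZMod p, k ≠ 0 ∧ k ≠ 1 ∧
      powerClass p (1 - u) = k • powerClass p u
  · obtain ⟨u, hu, k, hk0, hk1, hk⟩ := hmed
    exact ⟨_, isValuationDatum_span_of_residual hF hp hu hk0 hk1 hk⟩
  push Not at hmed
  have hN : ∀ H : Submodule (ZMod p) (PowerClassGroup p F), HasDichotomy p H := by
    intro H x hx
    have hx0 := powerClass_ne_zero_of_notMem hx
    obtain ⟨k, hk⟩ := hF x hx0
    by_cases h0 : k = 0
    · left; rw [hk, h0, zero_smul]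
    · by_cases h1 : k = 1
      · right; rw [hk, h1, one_smul]
      · exact absurd hk (hmed x hx0 k h0 h1)
  have hC : ∀ (H : Submodule (ZMod p) (PowerClassGroup p F)) (x : F), powerClass p x ∈ H →
      powerClass p x ≠ 0 → powerClass p (1 - x) ∈ H := by
    intro H x hx hx0
    obtain ⟨k, hk⟩ := hF x hx0
    rw [hk]
    exact H.smul_mem k hx
  by_cases hex : ∃ x y : F, IsSmall p (⊥ : Submodule (ZMod p) (PowerClassGroup p F)) x ∧
      IsSmall p (⊥ : Submodule (ZMod p) (PowerClassGroup p F)) y ∧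
      powerClass p (1 - (1 - x) * y) ≠ 0
  · obtain ⟨x, y, hx, hy, hxy⟩ := hex
    -- A second exceptional pair off the line of x would make both x'/x and x/x' small.
    refine ⟨powerClass p x, hN _, fun x' y' hx' hy' => ?_, hC _⟩
    by_contra hxy'
    have hx0 : powerClass p x ≠ 0 := powerClass_ne_zero_of_notMem hx.1
    have h1 := hx.div_of_exceptional hF hp (hN ⊥) hy hxy hx'.bot hx'.1
    have h2 := hx'.bot.div_of_exceptional hF hp (hN ⊥) hy'.bot hxy' hx (by
      intro h
      obtain ⟨r, hr⟩ := Submodule.mem_span_singleton.1 h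
      have := independent_of_notMem_span hx0 hx'.1 (-1) r (by rw [hr]; module)
      simp at this)
    rw [← inv_div] at h2
    exact h1.not_inv hp h2
  · push Not at hex
    refine ⟨0, hN _, fun x y hx hy => hex x y hx.bot hy.bot, hC _⟩

/-- A valuation ring such that all elements congruent to `1` are `p`-th powers and the classes of
the units modulo `p`-th powers lie on a line. -/
def HasRigidValuation (p : ℕ) (F : Type*) [Field F] : Prop :=
  ∃ (A : ValuationSubring F) (v : PowerClassGroup p F),
    (∀ x, A.valuation x < 1 → powerClass p (1 - x) = 0) ∧
      ∀ x, A.valuation x = 1 → ∃ k : ZMod p, powerClass p x = k • v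

theorem IsAdditivelyRigid.hasRigidValuation [Fact p.Prime] (hF : IsAdditivelyRigid p F)
    (hp : Odd p) : HasRigidValuation p F := by
  obtain ⟨v, hv⟩ := hF.exists_isValuationDatum hp
  refine ⟨hv.valuationSubring hp, v, fun x => hv.powerClass_one_sub_of_valuation_lt_one hp,
    fun x hx => ?_⟩
  obtain ⟨k, hk⟩ := Submodule.mem_span_singleton.1 (hv.powerClass_mem_of_valuation_eq_one hp hx)
  exact ⟨k, hk.symm⟩

end Existence

/-! ### Kummer generators -/

/-- `α` is a `p`-th root of `a`, which is not a `p`-th power in `F`, and generates `E` over `F`. -/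
structure IsKummerGenerator (p : ℕ) {F E : Type*} [Field F] [Field E] [Algebra F E] (a : F)
    (α : E) : Prop where
  notMem : a ∉ pthPowers p F
  pow_eq : α ^ p = algebraMap F E a
  adjoin_eq_top : IntermediateField.adjoin F {α} = ⊤

namespace IsKummerGenerator

variable {p : ℕ} {F E : Type*} [Field F] [Field E] [Algebra F E] {a : F} {α : E}

theorem irreducible (h : IsKummerGenerator p a α) (hp : p.Prime) :
    Irreducible (X ^ p - C a : F[X]) :=
  irreducible_X_pow_sub_C_of_notMem_pthPowers hp h.notMem

theorem minpoly_eq (h : IsKummerGenerator p a α) (hp : p.Prime) :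
    minpoly F α = X ^ p - C a := by
  refine (minpoly.eq_of_irreducible_of_monic (h.irreducible hp) ?_
    (monic_X_pow_sub_C a hp.ne_zero)).symm
  simp [h.pow_eq]

theorem isIntegral (h : IsKummerGenerator p a α) (hp : p.Prime) : IsIntegral F α := by
  refine ⟨X ^ p - C a, monic_X_pow_sub_C a hp.ne_zero, ?_⟩
  simp [h.pow_eq]

/-- The power basis given by a Kummer generator. -/
noncomputable def powerBasis (h : IsKummerGenerator p a α) (hp : p.Prime) : PowerBasis F E :=
  PowerBasis.ofAdjoinEqTop (h.isIntegral hp) (by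
    rw [← IntermediateField.adjoin_simple_toSubalgebra_of_isAlgebraic
      (h.isIntegral hp).isAlgebraic, h.adjoin_eq_top, IntermediateField.top_toSubalgebra])

@[simp]
theorem powerBasis_gen (h : IsKummerGenerator p a α) (hp : p.Prime) : (h.powerBasis hp).gen = α :=
  PowerBasis.ofAdjoinEqTop_gen _ _

theorem powerBasis_dim (h : IsKummerGenerator p a α) (hp : p.Prime) :
    (h.powerBasis hp).dim = p := by
  rw [← PowerBasis.natDegree_minpoly, powerBasis_gen, h.minpoly_eq hp, natDegree_X_pow_sub_C]

theorem finiteDimensional (h : IsKummerGenerator p a α) (hp : p.Prime) : FiniteDimensional F E :=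
  (h.powerBasis hp).finite

theorem finrank_eq (h : IsKummerGenerator p a α) (hp : p.Prime) : Module.finrank F E = p := by
  rw [PowerBasis.finrank (h.powerBasis hp), h.powerBasis_dim hp]

theorem exists_eq_sum (h : IsKummerGenerator p a α) (hp : p.Prime) (y : E) :
    ∃ c : ℕ → F, y = ∑ i ∈ Finset.range p, algebraMap F E (c i) * α ^ i := by
  have : Nontrivial E := inferInstance
  obtain ⟨f, hf, hy⟩ := (h.powerBasis hp).exists_eq_aeval y
  rw [powerBasis_gen] at hy
  refine ⟨f.coeff, ?_⟩
  rw [hy, aeval_eq_sum_range' (hf.trans_eq (h.powerBasis_dim hp))]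
  simp [Algebra.smul_def]

theorem ne_zero (h : IsKummerGenerator p a α) (hp : p.Prime) : a ≠ 0 := by
  rintro rfl
  exact h.notMem ⟨0, by simp [hp.ne_zero]⟩

theorem gen_ne_zero (h : IsKummerGenerator p a α) (hp : p.Prime) : α ≠ 0 := by
  rintro rfl
  have := h.pow_eq
  rw [zero_pow hp.ne_zero, eq_comm, map_eq_zero] at this
  exact h.ne_zero hp this

theorem norm_gen (h : IsKummerGenerator p a α) (hp : p.Prime) (hodd : Odd p) :
    Algebra.norm F α = a := by
  have := Algebra.PowerBasis.norm_gen_eq_coeff_zero_minpoly (h.powerBasis hp)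
  rw [powerBasis_gen, powerBasis_dim, h.minpoly_eq hp] at this
  rw [this]
  simp [hodd.neg_one_pow, hp.ne_zero.symm]

/-- The norm of 1 - α is the characteristic polynomial X^p - a of α evaluated at 1. -/
theorem norm_one_sub_gen (h : IsKummerGenerator p a α) (hp : p.Prime) :
    Algebra.norm F (1 - α) = 1 - a := by
  have h1 := charpoly_leftMulMatrix (h.powerBasis hp)
  have h2 := congrArg (eval 1) h1
  rw [powerBasis_gen, h.minpoly_eq hp, Matrix.eval_charpoly] at h2
  rw [Algebra.norm_eq_matrix_det (h.powerBasis hp).basis, map_sub, map_one]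
  simpa using h2

theorem isGalois_and_isCyclic (h : IsKummerGenerator p a α) (hp : p.Prime)
    (hζ : ∃ ζ : F, IsPrimitiveRoot ζ p) : IsGalois F E ∧ IsCyclic Gal(E/F) := by
  obtain ⟨ζ, hζ⟩ := hζ
  have := h.finiteDimensional hp
  have hf := h.finrank_eq hp
  have hK : (primitiveRoots (Module.finrank F E) F).Nonempty := by
    rw [hf]
    exact ⟨ζ, (mem_primitiveRoots hp.pos).2 hζ⟩
  have := (isCyclic_tfae F E hK).out 0 2
  exact this.2 ⟨α, ⟨a, by rw [hf, h.pow_eq]⟩, h.adjoin_eq_top⟩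

theorem exists_conj_eq (h : IsKummerGenerator p a α) (hp : p.Prime)
    (hζ : ∃ ζ : F, IsPrimitiveRoot ζ p) (σ : Gal(E/F)) :
    ∃ η : F, η ^ p = 1 ∧ σ α = algebraMap F E η * α := by
  obtain ⟨ζ, hζ⟩ := hζ
  have : NeZero p := ⟨hp.ne_zero⟩
  have h0 := h.gen_ne_zero hp
  have h1 : (σ α / α) ^ p = 1 := by
    rw [div_pow, ← map_pow, h.pow_eq, AlgEquiv.commutes, ← h.pow_eq, div_self (pow_ne_zero p h0)]
  obtain ⟨i, -, hi⟩ := (hζ.map_of_injective (algebraMap F E).injective).eq_pow_of_pow_eq_one h1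
  refine ⟨ζ ^ i, by rw [← pow_mul, mul_comm, pow_mul, hζ.pow_eq_one, one_pow], ?_⟩
  rw [map_pow, hi, div_mul_cancel₀ _ h0]

theorem div_algebraMap (h : IsKummerGenerator p a α) {c : F} (hc : c ≠ 0) :
    IsKummerGenerator p (a / c ^ p) (α / algebraMap F E c) where
  notMem := by
    rintro ⟨d, hd⟩
    refine h.notMem ⟨d * c, ?_⟩
    simp only at hd ⊢
    rw [mul_pow, hd, div_mul_cancel₀ _ (pow_ne_zero p hc)]
  pow_eq := by rw [div_pow, h.pow_eq, map_div₀, map_pow]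
  adjoin_eq_top := by
    rw [← h.adjoin_eq_top]
    refine le_antisymm (h.adjoin_eq_top ▸ le_top) ?_
    rw [IntermediateField.adjoin_simple_le_iff]
    have h1 := IntermediateField.mem_adjoin_simple_self F (α / algebraMap F E c)
    have h2 := mul_mem h1 (algebraMap_mem (IntermediateField.adjoin F {α / algebraMap F E c}) c)
    rwa [div_mul_cancel₀] at h2
    simpa using hc

end IsKummerGenerator

theorem isKummerGenerator_root {p : ℕ} {F : Type*} [Field F] {a : F}
    (ha : a ∉ pthPowers p F) [Fact (Irreducible (X ^ p - C a : F[X]))] :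
    IsKummerGenerator p a (AdjoinRoot.root (X ^ p - C a : F[X])) where
  notMem := ha
  pow_eq := by
    have := AdjoinRoot.eval₂_root (X ^ p - C a : F[X])
    rwa [eval₂_sub, eval₂_X_pow, eval₂_C, sub_eq_zero] at this
  adjoin_eq_top := IntermediateField.adjoin_root_eq_top _

theorem IsPRigidField.isAdditivelyRigid {p : ℕ} (hp : p.Prime) {F : Type*} [Field F]
    (hF : IsPRigidField p F) : IsAdditivelyRigid p F := by
  intro a ha
  have ha' : a ∉ pthPowers p F := fun h => ha ((powerClass_eq_zero_iff hp.ne_zero).2 h)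
  have : Fact (Irreducible (X ^ p - C a : F[X])) :=
    ⟨irreducible_X_pow_sub_C_of_notMem_pthPowers hp ha'⟩
  obtain ⟨k, hk⟩ := (isPRigidElement_iff hp ha').1 (hF a ha') (1 - AdjoinRoot.root _)
  refine ⟨k, ?_⟩
  rw [← hk]
  congr 1
  exact ((isKummerGenerator_root ha').norm_one_sub_gen hp).symm

/-! ### Hilbert 90 and power classes of a Kummer extension -/

section Hilbert90

/-- Hilbert's Theorem 90 for cyclic extensions. -/
theorem exists_ne_zero_mul_eq_of_norm_eq_one {K L : Type*} [Field K] [Field L] [Algebra K L]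
    [FiniteDimensional K L] [IsGalois K L] {g : Gal(L/K)}
    (hg : ∀ x, x ∈ Subgroup.zpowers g) {x : L} (hx : Algebra.norm K x = 1) :
    ∃ z : L, z ≠ 0 ∧ x * g z = z := by
  classical
  obtain ⟨n, hn⟩ : ∃ n, n = orderOf g := ⟨_, rfl⟩
  have hfin : IsOfFinOrder g := isOfFinOrder_of_finite g
  have hn0 : 0 < n := hn ▸ hfin.orderOf_pos
  have hpow : ∀ i j : Fin n, g ^ (i : ℕ) = g ^ (j : ℕ) → i = j := fun i j hij =>
    Fin.ext (pow_injOn_Iio_orderOf (hn ▸ i.2) (hn ▸ j.2) hij)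
  -- Partial norm products: P 0 = 1 and P n is the full norm, also 1. They are the coefficients of a
  -- resolvent, which is nonzero for some y by independence of characters.
  let P : ℕ → L := fun i => ∏ j ∈ Finset.range i, (g ^ j) x
  have hP0 : P 0 = 1 := by simp [P]
  have hPn : P n = 1 := by
    have h1 := Algebra.norm_eq_prod_automorphisms K x
    rw [hx, map_one] at h1
    change ∏ j ∈ Finset.range n, (g ^ j) x = 1
    rw [h1, ← Fin.prod_univ_eq_prod_range (fun j => (g ^ j) x) n]
    let e : Fin n → Gal(L/K) := fun j => g ^ (j : ℕ)
    have he : Function.Bijective e := by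
      constructor
      · exact hpow
      · intro y
        obtain ⟨i, hi, rfl⟩ := (hfin.mem_zpowers_iff_mem_range_orderOf.1 (hg y) |>
          Finset.mem_image.1)
        exact ⟨⟨i, by simpa [hn] using hi⟩, rfl⟩
    exact Fintype.prod_bijective e he _ _ fun _ => rfl
  have hPs : ∀ i, P (i + 1) = x * g (P i) := by
    intro i
    simp only [P]
    rw [Finset.prod_range_succ', map_prod, mul_comm]
    simp [pow_succ']
  have hex : ∃ y : L, ∑ i ∈ Finset.range n, P i * (g ^ i) y ≠ 0 := by
    by_contra! h
    let φ : Fin n → (L →* L) := fun i => ((g ^ (i : ℕ) : Gal(L/K)) : L →* L)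
    have hφ : Function.Injective φ := by
      intro i j hij
      refine hpow i j ?_
      ext y
      exact DFunLike.congr_fun hij y
    have hli := (linearIndependent_monoidHom L L).comp φ hφ
    rw [Fintype.linearIndependent_iff] at hli
    have := hli (fun i => P i) (by
      ext y
      have := h y
      rw [← Fin.sum_univ_eq_sum_range (fun i => P i * (g ^ i) y) n] at this
      simpa [φ] using this) ⟨0, hn0⟩
    simp [hP0] at this
  obtain ⟨y, hy⟩ := hex
  refine ⟨_, hy, ?_⟩
  have h1 : x * g (∑ i ∈ Finset.range n, P i * (g ^ i) y) =
      ∑ i ∈ Finset.range n, P (i + 1) * (g ^ (i + 1)) y := by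
    rw [map_sum, Finset.mul_sum]
    refine Finset.sum_congr rfl fun i _ => ?_
    rw [hPs, map_mul, pow_succ', AlgEquiv.mul_apply]
    ring
  have h2 := Finset.sum_range_succ' (fun i => P i * (g ^ i) y) n
  rw [Finset.sum_range_succ, hPn, hP0, hn, pow_orderOf_eq_one, pow_zero] at h2
  rw [h1]
  rw [hn] at *
  exact (add_right_cancel h2).symm

end Hilbert90

section Decomposition

variable {p : ℕ} {F E : Type*} [Field F] [Field E] [Algebra F E] {a : F} {α : E}

/-- Modulo p, the binomial theorem gives (s - 1)^p = s^p - 1, and this vanishes. -/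
theorem exists_sub_one_pow_apply_eq_smul {M : Type*} [AddCommGroup M] {p : ℕ} (hp : p.Prime)
    (hodd : Odd p) {s : AddMonoid.End M} (hs : s ^ p = 1) (z : M) :
    ∃ w : M, ((s - 1) ^ p) z = p • w := by
  obtain ⟨r, hr⟩ := (Commute.neg_one_right s).exists_add_pow_prime_eq hp
  rw [hodd.neg_one_pow, hs, add_neg_cancel, zero_add] at hr
  refine ⟨(s * -1 * r) z, ?_⟩
  rw [sub_eq_add_neg, hr, mul_assoc, mul_assoc, ← mul_assoc s, ← nsmul_eq_mul]
  rfl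

/-- If norms from `E = F(α)` lie in the powers of `a` modulo `p`-th powers, then `E` is generated
modulo `p`-th powers by `α` and `F`. -/
theorem IsKummerGenerator.exists_eq_mul_pow (h : IsKummerGenerator p a α) (hp : p.Prime)
    (hodd : Odd p) (hζ : ∃ ζ : F, IsPrimitiveRoot ζ p)
    (hN : ∀ y : E, ∃ (k : ℕ) (c : F), Algebra.norm F y = a ^ k * c ^ p) {y : E} (hy : y ≠ 0) :
    ∃ (i : ℕ) (f : F) (z : E), y = α ^ i * algebraMap F E f * z ^ p := by
  have := h.finiteDimensional hp
  obtain ⟨hgal, hcyc⟩ := h.isGalois_and_isCyclic hp hζ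
  obtain ⟨σ, hσ⟩ := hcyc.exists_generator
  have hα0 := h.gen_ne_zero hp
  let s : AddMonoid.End (Additive Eˣ) := MonoidHom.toAdditive (Units.map (σ : E →* E))
  have hs_val : ∀ u : Additive Eˣ, ((s u).toMul : E) = σ (u.toMul : E) := fun u => rfl
  have hsp_val : ∀ (n : ℕ) (u : Additive Eˣ), (((s ^ n) u).toMul : E) = (σ ^ n) (u.toMul : E) := by
    intro n
    induction n with
    | zero => intro u; rfl
    | succ n ih =>
      intro u
      rw [pow_succ, pow_succ, AlgEquiv.mul_apply, ← hs_val, ← ih]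
      rfl
  have hsp : s ^ p = 1 := by
    refine AddMonoidHom.ext fun u => Additive.toMul.injective (Units.ext ?_)
    have : σ ^ p = 1 := by
      rw [← h.finrank_eq hp, ← IsGalois.card_aut_eq_finrank]
      exact pow_card_eq_one'
    exact (hsp_val p u).trans (by rw [this]; rfl)
  let S : Additive Eˣ → Prop := fun u =>
    ∃ (i : ℕ) (f : F), (u.toMul : E) = α ^ i * algebraMap F E f
  have hSadd : ∀ u v, S u → S v → S (u + v) := by
    rintro u v ⟨i, f, hu⟩ ⟨j, g, hv⟩
    refine ⟨i + j, f * g, ?_⟩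
    rw [toMul_add, Units.val_mul, hu, hv, map_mul]
    ring
  have hSD : ∀ u, S u → S ((s - 1) u) := by
    rintro u ⟨i, f, hu⟩
    obtain ⟨η, -, hη⟩ := h.exists_conj_eq hp hζ σ
    have hu0 : (u.toMul : E) ≠ 0 := u.toMul.ne_zero
    refine ⟨0, η ^ i, ?_⟩
    change (((s u - u).toMul : Eˣ) : E) = _
    rw [toMul_sub, Units.val_div_eq_div_val, hs_val, hu, map_mul, map_pow, hη, AlgEquiv.commutes,
      mul_pow, map_pow, pow_zero, one_mul, div_eq_iff (hu ▸ hu0)]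
    ring
  have hSDn : ∀ (n : ℕ) u, S u → S (((s - 1) ^ n) u) := by
    intro n
    induction n with
    | zero => intro u hu; exact hu
    | succ n ih =>
      intro u hu
      rw [pow_succ]
      exact ih _ (hSD u hu)
  have hsub : ∀ u, (s - 1) u = s u - u := fun u => rfl
  -- The element u has the same norm as some α^k c, so Hilbert 90 writes their quotient as an (s -
  -- 1)-image. Iterating p times is possible because S is stable under s - 1, and it turns the error
  -- term into a p-th power.
  have hbase : ∀ u : Additive Eˣ, ∃ v z, S v ∧ u = v + (s - 1) z := by
    intro u
    have hu0 : (u.toMul : E) ≠ 0 := u.toMul.ne_zero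
    obtain ⟨k, c, hk⟩ := hN (u.toMul : E)
    have hc0 : c ≠ 0 := by
      rintro rfl
      rw [zero_pow hp.ne_zero, mul_zero, Algebra.norm_eq_zero_iff] at hk
      exact hu0 hk
    have hc0' : algebraMap F E c ≠ 0 := by simpa using hc0
    have hv0 : α ^ k * algebraMap F E c ≠ 0 := mul_ne_zero (pow_ne_zero _ hα0) hc0'
    have h1 : Algebra.norm F ((u.toMul : E) / (α ^ k * algebraMap F E c)) = 1 := by
      have h2 := map_mul (Algebra.norm F) ((u.toMul : E) / (α ^ k * algebraMap F E c))
        (α ^ k * algebraMap F E c)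
      rw [div_mul_cancel₀ _ hv0, hk, map_mul, map_pow, h.norm_gen hp hodd,
        Algebra.norm_algebraMap, h.finrank_eq hp] at h2
      exact (mul_eq_right₀ (mul_ne_zero (pow_ne_zero _ (h.ne_zero hp))
        (pow_ne_zero _ hc0))).1 h2.symm
    obtain ⟨z, hz0, hz⟩ := exists_ne_zero_mul_eq_of_norm_eq_one hσ h1
    refine ⟨Additive.ofMul (Units.mk0 _ hv0), -Additive.ofMul (Units.mk0 z hz0), ⟨k, c, rfl⟩, ?_⟩
    apply Additive.toMul.injective
    apply Units.ext
    rw [hsub, toMul_add, Units.val_mul, toMul_sub, Units.val_div_eq_div_val, hs_val]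
    simp only [toMul_neg, toMul_ofMul, Units.val_inv_eq_inv_val, Units.val_mk0, map_inv₀]
    have hσz : σ z ≠ 0 := by simpa using hz0
    field_simp
    field_simp at hz
    rw [hz]
  have hiter : ∀ (n : ℕ) (u : Additive Eˣ), ∃ v z, S v ∧ u = v + ((s - 1) ^ n) z := by
    intro n
    induction n with
    | zero =>
      intro u
      exact ⟨0, u, ⟨0, 1, by simp⟩, by simp⟩
    | succ n ih =>
      intro u
      obtain ⟨v, z, hv, rfl⟩ := ih u
      obtain ⟨v', z', hv', rfl⟩ := hbase z
      refine ⟨v + ((s - 1) ^ n) v', z', hSadd _ _ hv (hSDn n _ hv'), ?_⟩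
      rw [map_add, pow_succ, add_assoc]
      rfl
  obtain ⟨v, z, ⟨i, f, hv⟩, hu⟩ := hiter p (Additive.ofMul (Units.mk0 y hy))
  obtain ⟨w, hw⟩ := exists_sub_one_pow_apply_eq_smul hp hodd hsp z
  refine ⟨i, f, (w.toMul : E), ?_⟩
  rw [hw] at hu
  have := congrArg (fun u : Additive Eˣ => ((u.toMul : Eˣ) : E)) hu
  simpa [hv] using this

end Decomposition

/-! ### Extending valuations -/

section Extension

variable {F E : Type*} [Field F] [Field E] [Algebra F E]

/-- Chevalley: a valuation ring of E dominates the image of A. If x is outside A but in its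
contraction, then x⁻¹ becomes a unit upstairs, so locality already makes it a unit of A. -/
theorem ValuationSubring.exists_comap_eq (A : ValuationSubring F) :
    ∃ B : ValuationSubring E, B.comap (algebraMap F E) = A := by
  obtain ⟨B, hAB, hloc⟩ := (A.toLocalSubring.map (algebraMap F E)).exists_le_valuationSubring
  have hmem : ∀ x ∈ A, algebraMap F E x ∈ B := fun x hx => hAB ⟨x, hx, rfl⟩
  refine ⟨B, ?_⟩
  ext x
  rw [ValuationSubring.mem_comap]
  refine ⟨fun hx => ?_, hmem x⟩
  by_contra hxA
  have hxA' := (A.mem_or_inv_mem x).resolve_left hxA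
  have hx0 : x ≠ 0 := by rintro rfl; exact hxA A.zero_mem
  have hx0' : algebraMap F E x ≠ 0 := by simpa using hx0
  have hu := hloc.map_nonunit ⟨algebraMap F E x⁻¹, ⟨x⁻¹, hxA', rfl⟩⟩ (by
    refine IsUnit.of_mul_eq_one ⟨algebraMap F E x, hx⟩ (Subtype.ext ?_)
    change algebraMap F E x⁻¹ * algebraMap F E x = 1
    rw [map_inv₀, inv_mul_cancel₀ hx0'])
  obtain ⟨⟨y, z, hz, hzy⟩, hy⟩ := isUnit_iff_exists_inv.1 hu
  have h1 : algebraMap F E x⁻¹ * y = 1 := congrArg Subtype.val hy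
  have h2 : algebraMap F E z = y := hzy
  have h3 : z = x := by
    apply (algebraMap F E).injective
    rw [h2]
    rw [map_inv₀, inv_mul_eq_one₀ hx0'] at h1
    exact h1.symm
  exact hxA (h3 ▸ hz)

end Extension

/-- `B` is a valuation ring of an extension of `F` whose restriction to `F` is as in
`HasRigidValuation`. -/
structure IsRigidOver (p : ℕ) (F : Type*) {E : Type*} [Field F] [Field E] [Algebra F E]
    (B : ValuationSubring E) (v : PowerClassGroup p F) : Prop where
  powerClass_one_sub : ∀ x : F, B.valuation (algebraMap F E x) < 1 → powerClass p (1 - x) = 0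
  exists_eq_smul : ∀ x : F, B.valuation (algebraMap F E x) = 1 → ∃ k : ZMod p,
    powerClass p x = k • v

/-! ### Powers of a Kummer generator as a valuation basis -/

section

variable {p : ℕ} {F E : Type*} [Field F] [Field E] [Algebra F E] {a : F} {α : E}
  {B : ValuationSubring E} {v : PowerClassGroup p F}

theorem ValuationSubring.valuation_comap_lt_one_iff {x : F} :
    (B.comap (algebraMap F E)).valuation x < 1 ↔ B.valuation (algebraMap F E x) < 1 := by
  rw [← ValuationSubring.mem_nonunits_iff, ← ValuationSubring.mem_nonunits_iff,
    ValuationSubring.mem_nonunits_iff_or, ValuationSubring.mem_nonunits_iff_or,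
    ValuationSubring.mem_comap, map_inv₀, map_eq_zero]

theorem ValuationSubring.valuation_comap_eq_one_iff {x : F} :
    (B.comap (algebraMap F E)).valuation x = 1 ↔ B.valuation (algebraMap F E x) = 1 := by
  rw [eq_iff_le_not_lt, eq_iff_le_not_lt, valuation_comap_lt_one_iff,
    ValuationSubring.valuation_le_one_iff, ValuationSubring.valuation_le_one_iff,
    ValuationSubring.mem_comap]

theorem HasRigidValuation.exists_isRigidOver (h : HasRigidValuation p F) (E : Type*) [Field E]
    [Algebra F E] : ∃ (B : ValuationSubring E) (v : PowerClassGroup p F), IsRigidOver p F B v := by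
  obtain ⟨A, v, h1, h2⟩ := h
  obtain ⟨B, rfl⟩ := A.exists_comap_eq (E := E)
  exact ⟨B, v, fun x hx => h1 x (ValuationSubring.valuation_comap_lt_one_iff.2 hx),
    fun x hx => h2 x (ValuationSubring.valuation_comap_eq_one_iff.2 hx)⟩

/-- The powers of `α` form a valuation basis. -/
def IsValuationBasis (p : ℕ) (F : Type*) {E : Type*} [Field F] [Field E] [Algebra F E]
    (B : ValuationSubring E) (α : E) : Prop :=
  ∀ c : ℕ → F, ∃ i ∈ Finset.range p,
    B.valuation (∑ j ∈ Finset.range p, algebraMap F E (c j) * α ^ j) =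
      B.valuation (algebraMap F E (c i) * α ^ i) ∧
    ∀ j ∈ Finset.range p, B.valuation (algebraMap F E (c j) * α ^ j) ≤
      B.valuation (algebraMap F E (c i) * α ^ i)

theorem valuation_eq_one_of_pow_eq_one {Γ R : Type*} [Ring R]
    [LinearOrderedCommGroupWithZero Γ] (w : Valuation R Γ) {n : ℕ} (hn : n ≠ 0) {x : R}
    (hx : x ^ n = 1) : w x = 1 := by
  have : w x ^ n = 1 := by rw [← map_pow, hx, map_one]
  exact (pow_eq_one_iff.1 this).resolve_right hn

/-- An automorphism multiplies α by a root of unity, so it does not change the valuation of any term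
of the expansion. -/
theorem IsValuationBasis.valuation_apply_eq (hB : IsValuationBasis p F B α)
    (h : IsKummerGenerator p a α) (hp : p.Prime) (hζ : ∃ ζ : F, IsPrimitiveRoot ζ p)
    (σ : Gal(E/F)) (y : E) : B.valuation (σ y) = B.valuation y := by
  obtain ⟨c, rfl⟩ := h.exists_eq_sum hp y
  obtain ⟨η, hη1, hη⟩ := h.exists_conj_eq hp hζ σ
  have hσ : σ (∑ j ∈ Finset.range p, algebraMap F E (c j) * α ^ j) =
      ∑ j ∈ Finset.range p, algebraMap F E (c j * η ^ j) * α ^ j := by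
    rw [map_sum]
    refine Finset.sum_congr rfl fun j _ => ?_
    rw [map_mul, map_pow, AlgEquiv.commutes, hη, map_mul, map_pow, mul_pow, mul_assoc]
  have hw : ∀ j, B.valuation (algebraMap F E (c j * η ^ j) * α ^ j) =
      B.valuation (algebraMap F E (c j) * α ^ j) := by
    intro j
    have h1 : B.valuation (algebraMap F E η) = 1 :=
      valuation_eq_one_of_pow_eq_one _ hp.ne_zero (by rw [← map_pow, hη1, map_one])
    simp only [map_mul, map_pow, h1, one_pow, mul_one]
  rw [hσ]
  obtain ⟨i, hi, hi1, hi2⟩ := hB c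
  obtain ⟨j, hj, hj1, hj2⟩ := hB fun j => c j * η ^ j
  rw [hi1, hj1, hw]
  refine le_antisymm (hi2 j hj) ?_
  have := hj2 i hi
  rwa [hw, hw] at this

/-! ### The totally ramified case -/

/-- If n were prime to p, a Bézout exponent would make the value of a a p-th power of a value from
F. -/
theorem IsKummerGenerator.dvd_of_valuation_eq_pow (h : IsKummerGenerator p a α) (hp : p.Prime)
    (hram : ∀ c : F, B.valuation (algebraMap F E a) ≠ B.valuation (algebraMap F E c) ^ p)
    {c : F} {n : ℕ} (hc : B.valuation (algebraMap F E c) = B.valuation α ^ n) : p ∣ n := by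
  by_contra hn
  have hcop : Nat.Coprime n p := ((Nat.Prime.coprime_iff_not_dvd hp).2 hn).symm
  obtain ⟨m, hm⟩ := Nat.exists_mul_mod_eq_one_of_coprime hcop hp.one_lt
  have ha0 : B.valuation (algebraMap F E a) ≠ 0 := by
    simpa using h.ne_zero hp
  have hq : n * m = 1 + p * (n * m / p) := by
    rw [← hm.2]
    exact (Nat.mod_add_div _ _).symm
  apply hram (c ^ m / a ^ (n * m / p))
  have h1 : B.valuation (algebraMap F E a) ^ (n * m) = B.valuation (algebraMap F E c) ^ (m * p) := by
    rw [hc, ← h.pow_eq, map_pow, ← pow_mul, ← pow_mul]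
    congr 1
    ring
  rw [hq, pow_add, pow_one] at h1
  rw [map_div₀, map_pow, map_pow, map_div₀, map_pow, map_pow, div_pow, ← pow_mul, ← h1, ← pow_mul,
    mul_comm (n * m / p) p, mul_div_cancel_right₀ _ (pow_ne_zero _ ha0)]

/-- The values of distinct powers α^i, i < p, lie in distinct cosets of the value group of F, so one
nonzero term strictly dominates. -/
theorem IsKummerGenerator.exists_eq_mul_one_add (h : IsKummerGenerator p a α) (hp : p.Prime)
    (hram : ∀ c : F, B.valuation (algebraMap F E a) ≠ B.valuation (algebraMap F E c) ^ p)
    {c : ℕ → F} (hc : ∑ j ∈ Finset.range p, algebraMap F E (c j) * α ^ j ≠ 0) :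
    ∃ i ∈ Finset.range p, c i ≠ 0 ∧ (∀ j ∈ Finset.range p,
        B.valuation (algebraMap F E (c j) * α ^ j) ≤ B.valuation (algebraMap F E (c i) * α ^ i)) ∧
      ∃ z : E, B.valuation z < 1 ∧ ∑ j ∈ Finset.range p, algebraMap F E (c j) * α ^ j =
        algebraMap F E (c i) * α ^ i * (1 + z) := by
  have hα0 := h.gen_ne_zero hp
  obtain ⟨i, hi, hmax⟩ := (Finset.range p).exists_max_image
    (fun j => B.valuation (algebraMap F E (c j) * α ^ j)) ⟨0, by simpa using hp.pos⟩
  have hi0 : algebraMap F E (c i) * α ^ i ≠ 0 := by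
    intro h0
    apply hc
    refine Finset.sum_eq_zero fun j hj => ?_
    have := hmax j hj
    rwa [h0, map_zero, le_zero_iff, map_eq_zero] at this
  have hci : c i ≠ 0 := by
    intro h0
    rw [h0, map_zero, zero_mul] at hi0
    exact hi0 rfl
  refine ⟨i, hi, hci, hmax, (∑ j ∈ (Finset.range p).erase i, algebraMap F E (c j) * α ^ j) /
    (algebraMap F E (c i) * α ^ i), ?_, ?_⟩
  · have hv0 : B.valuation (algebraMap F E (c i) * α ^ i) ≠ 0 := by simpa using hi0
    rw [map_div₀, div_lt_one₀ (zero_lt_iff.2 hv0)]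
    refine Valuation.map_sum_lt _ hv0 fun j hj => ?_
    obtain ⟨hji, hj⟩ := Finset.mem_erase.1 hj
    refine lt_of_le_of_ne (hmax j hj) fun heq => ?_
    have hαv : B.valuation α ≠ 0 := by simpa using hα0
    have hciv : B.valuation (algebraMap F E (c i)) ≠ 0 := by simpa using hci
    have hcj : B.valuation (algebraMap F E (c j)) ≠ 0 := by
      intro h0
      rw [map_mul, h0, zero_mul] at heq
      exact hv0 heq.symm
    rw [Finset.mem_range] at hi hj
    rw [map_mul, map_mul, map_pow, map_pow] at heq
    rcases lt_or_gt_of_ne hji with hlt | hlt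
    · have h1 : B.valuation (algebraMap F E (c j / c i)) = B.valuation α ^ (i - j) := by
        rw [map_div₀, map_div₀, div_eq_iff hciv]
        apply mul_right_cancel₀ (pow_ne_zero j hαv)
        rw [heq, mul_right_comm, ← pow_add, Nat.sub_add_cancel hlt.le, mul_comm]
      have := Nat.le_of_dvd (by omega) (h.dvd_of_valuation_eq_pow hp hram h1)
      omega
    · have h1 : B.valuation (algebraMap F E (c i / c j)) = B.valuation α ^ (j - i) := by
        rw [map_div₀, map_div₀, div_eq_iff hcj]
        apply mul_right_cancel₀ (pow_ne_zero i hαv)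
        rw [← heq, mul_right_comm, ← pow_add, Nat.sub_add_cancel hlt.le, mul_comm]
      have := Nat.le_of_dvd (by omega) (h.dvd_of_valuation_eq_pow hp hram h1)
      omega
  · rw [mul_add, mul_one, mul_div_cancel₀ _ hi0]
    exact (Finset.add_sum_erase _ (fun j => algebraMap F E (c j) * α ^ j) hi).symm

theorem valuation_one_add_eq_one {z : E} (hz : B.valuation z < 1) : B.valuation (1 + z) = 1 := by
  have := Valuation.map_add_eq_of_lt_left B.valuation (x := 1) (y := z) (by simpa using hz)
  simpa using this

theorem IsKummerGenerator.isValuationBasis_of_ramified (h : IsKummerGenerator p a α)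
    (hp : p.Prime)
    (hram : ∀ c : F, B.valuation (algebraMap F E a) ≠ B.valuation (algebraMap F E c) ^ p) :
    IsValuationBasis p F B α := by
  intro c
  by_cases hc : ∑ j ∈ Finset.range p, algebraMap F E (c j) * α ^ j = 0
  · have hc' : ∀ j ∈ Finset.range p, c j = 0 := by
      have hli := (h.powerBasis hp).basis.linearIndependent
      rw [Fintype.linearIndependent_iff] at hli
      have hd := h.powerBasis_dim hp
      intro j hj
      refine hli (fun i => c i) ?_ ⟨j, by rw [hd]; exact Finset.mem_range.1 hj⟩
      simp only [PowerBasis.basis_eq_pow, powerBasis_gen, Algebra.smul_def]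
      rw [Fin.sum_univ_eq_sum_range (fun j => algebraMap F E (c j) * α ^ j), hd, hc]
    have h0 : (0 : ℕ) ∈ Finset.range p := by simpa using hp.pos
    refine ⟨0, h0, ?_, fun j hj => ?_⟩
    · rw [hc, hc' 0 h0]; simp
    · rw [hc' j hj, hc' 0 h0]; simp
  · obtain ⟨i, hi, -, hmax, z, hz, hsum⟩ := h.exists_eq_mul_one_add hp hram hc
    refine ⟨i, hi, ?_, hmax⟩
    rw [hsum, map_mul, valuation_one_add_eq_one hz, mul_one]

/-! ### The unramified case -/

/-- If a were congruent to c^p, then c^p/a would be a principal unit, hence a p-th power, and so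
would a. -/
theorem IsRigidOver.not_valuation_sub_pow_lt_one (hB : IsRigidOver p F B v) (hp : p.Prime)
    (ha : a ∉ pthPowers p F) (ha1 : B.valuation (algebraMap F E a) = 1) (c : F) :
    ¬ B.valuation (algebraMap F E (a - c ^ p)) < 1 := by
  intro hlt
  have ha0 : a ≠ 0 := by rintro rfl; simp at ha1
  have h1 := hB.powerClass_one_sub ((a - c ^ p) / a) (by
    rw [map_div₀, map_div₀, ha1, div_one]; exact hlt)
  rw [show 1 - (a - c ^ p) / a = c ^ p / a by field_simp; ring] at h1
  have hc : c ^ p ≠ 0 := by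
    intro hc
    rw [hc, sub_zero, ha1] at hlt
    exact lt_irrefl _ hlt
  rw [powerClass_div hc ha0, powerClass_pow_self, zero_sub, neg_eq_zero,
    powerClass_eq_zero_iff hp.ne_zero] at h1
  exact ha h1

/-- The reduction of X^p - a is irreducible by `hres` and kills the residue of α. A nonzero
polynomial of degree below p is coprime to it and cannot vanish there as well. -/
theorem IsKummerGenerator.valuation_sum_eq_one (h : IsKummerGenerator p a α) (hp : p.Prime)
    (hα : B.valuation α = 1)
    (hres : ∀ c : F, ¬ B.valuation (algebraMap F E (a - c ^ p)) < 1) {c : ℕ → F}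
    (hc : ∀ j ∈ Finset.range p, B.valuation (algebraMap F E (c j)) ≤ 1) {i : ℕ}
    (hi : i ∈ Finset.range p) (hci : c i = 1) :
    B.valuation (∑ j ∈ Finset.range p, algebraMap F E (c j) * α ^ j) = 1 := by
  have hle : B.valuation (∑ j ∈ Finset.range p, algebraMap F E (c j) * α ^ j) ≤ 1 := by
    refine Valuation.map_sum_le _ fun j hj => ?_
    rw [map_mul, map_pow, hα, one_pow, mul_one]
    exact hc j hj
  refine le_antisymm hle (not_lt.1 fun hlt => ?_)
  let A := B.comap (algebraMap F E)
  let g : A →+* B := ((algebraMap F E).comp A.subtype).codRestrict B fun x => x.2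
  have : IsLocalHom g := by
    refine ⟨fun x hx => ?_⟩
    rw [ValuationSubring.valuation_eq_one_iff] at hx ⊢
    exact ValuationSubring.valuation_comap_eq_one_iff.2 hx
  let φ : IsLocalRing.ResidueField A →+* IsLocalRing.ResidueField B :=
    IsLocalRing.ResidueField.map g
  have hφ : ∀ x : A, φ (IsLocalRing.residue A x) = IsLocalRing.residue B (g x) := fun x => rfl
  have hzero : ∀ x : B, B.valuation (x : E) < 1 → IsLocalRing.residue B x = 0 := by
    intro x hx
    rw [IsLocalRing.residue_eq_zero_iff]
    exact (B.valuation_lt_one_iff x).2 hx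
  have hzero' : ∀ x : A, IsLocalRing.residue A x = 0 → B.valuation (algebraMap F E x) < 1 := by
    intro x hx
    rw [IsLocalRing.residue_eq_zero_iff] at hx
    exact ValuationSubring.valuation_comap_lt_one_iff.1 ((A.valuation_lt_one_iff x).1 hx)
  have hαB : α ∈ B := (B.valuation_le_one_iff α).1 hα.le
  have haA : a ∈ A := by
    change algebraMap F E a ∈ B
    rw [← h.pow_eq]
    exact pow_mem hαB p
  classical
  let d : ℕ → A := fun j => if hj : j ∈ Finset.range p then
    ⟨c j, (B.valuation_le_one_iff _).1 (hc j hj)⟩ else 0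
  have hd : ∀ j ∈ Finset.range p, ((d j : A) : F) = c j := by
    intro j hj
    simp only [d, dif_pos hj]
  let αB : B := ⟨α, hαB⟩
  let Q : (IsLocalRing.ResidueField A)[X] := X ^ p - C (IsLocalRing.residue A ⟨a, haA⟩)
  have hQ : Irreducible Q := by
    refine X_pow_sub_C_irreducible_of_prime hp fun b hb => ?_
    obtain ⟨b, rfl⟩ := IsLocalRing.residue_surjective b
    refine hres b (hzero' (⟨a, haA⟩ - b ^ p) ?_)
    rw [map_sub, map_pow, hb, sub_self]
  let P : (IsLocalRing.ResidueField A)[X] :=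
    ∑ j ∈ Finset.range p, C (IsLocalRing.residue A (d j)) * X ^ j
  have hPcoeff : P.coeff i = 1 := by
    simp only [P, finsetSum_coeff, coeff_C_mul_X_pow]
    rw [Finset.sum_eq_single i (fun j _ hj => if_neg hj.symm) (fun h => absurd hi h), if_pos rfl,
      show d i = 1 from Subtype.ext ((hd i hi).trans hci), map_one]
  have hP0 : P ≠ 0 := by
    intro h0
    rw [h0, coeff_zero] at hPcoeff
    exact zero_ne_one hPcoeff
  have hPdeg : P.degree < Q.degree := by
    rw [degree_X_pow_sub_C hp.pos]
    refine (degree_sum_le _ _).trans_lt ?_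
    rw [Finset.sup_lt_iff (by exact_mod_cast WithBot.bot_lt_coe p)]
    intro j hj
    refine (degree_C_mul_X_pow_le _ _).trans_lt ?_
    exact_mod_cast Finset.mem_range.1 hj
  have hcop : IsCoprime Q P :=
    hQ.coprime_iff_not_dvd.2 fun hdvd => absurd (degree_le_of_dvd hdvd hP0) (not_le.2 hPdeg)
  have hPeval : P.eval₂ φ (IsLocalRing.residue B αB) = 0 := by
    simp only [P, eval₂_finsetSum, eval₂_mul, eval₂_C, eval₂_X_pow, hφ]
    simp only [← map_pow, ← map_mul, ← map_sum]
    apply hzero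
    have : ((∑ j ∈ Finset.range p, g (d j) * αB ^ j : B) : E) =
        ∑ j ∈ Finset.range p, algebraMap F E (c j) * α ^ j := by
      rw [AddSubmonoidClass.coe_finsetSum]
      refine Finset.sum_congr rfl fun j hj => ?_
      rw [← hd j hj]
      rfl
    rw [this]
    exact hlt
  have hQeval : Q.eval₂ φ (IsLocalRing.residue B αB) = 0 := by
    simp only [Q, eval₂_sub, eval₂_X_pow, eval₂_C, hφ, ← map_pow, ← map_sub]
    apply hzero
    have : ((αB ^ p - g ⟨a, haA⟩ : B) : E) = 0 := by
      change α ^ p - algebraMap F E a = 0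
      rw [h.pow_eq, sub_self]
    rw [this, map_zero]
    exact zero_lt_one
  obtain ⟨r, s, hrs⟩ := hcop
  have := congrArg (eval₂ φ (IsLocalRing.residue B αB)) hrs
  rw [eval₂_add, eval₂_mul, eval₂_mul, hPeval, hQeval, mul_zero, mul_zero, add_zero,
    eval₂_one] at this
  exact zero_ne_one this

theorem IsKummerGenerator.isValuationBasis_of_unramified (h : IsKummerGenerator p a α)
    (hp : p.Prime) (hα : B.valuation α = 1)
    (hres : ∀ c : F, ¬ B.valuation (algebraMap F E (a - c ^ p)) < 1) :
    IsValuationBasis p F B α := by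
  intro c
  obtain ⟨i, hi, hmax⟩ := (Finset.range p).exists_max_image
    (fun j => B.valuation (algebraMap F E (c j) * α ^ j)) ⟨0, by simpa using hp.pos⟩
  refine ⟨i, hi, ?_, hmax⟩
  simp only [map_mul, map_pow, hα, one_pow, mul_one] at hmax ⊢
  by_cases hci : c i = 0
  · rw [hci, map_zero, map_zero]
    rw [Finset.sum_eq_zero, map_zero]
    intro j hj
    have := hmax j hj
    rw [hci, map_zero, map_zero, le_zero_iff, map_eq_zero] at this
    rw [this, zero_mul]
  · have hci' : algebraMap F E (c i) ≠ 0 := by simpa using hci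
    have hciv : B.valuation (algebraMap F E (c i)) ≠ 0 := by simpa using hci
    have h1 := h.valuation_sum_eq_one hp hα hres (c := fun j => c j / c i) (fun j hj => by
      rw [map_div₀, map_div₀]
      exact (div_le_one₀ (zero_lt_iff.2 hciv)).2 (hmax j hj)) hi (div_self hci)
    have h2 : ∑ j ∈ Finset.range p, algebraMap F E (c j) * α ^ j = algebraMap F E (c i) *
        ∑ j ∈ Finset.range p, algebraMap F E (c j / c i) * α ^ j := by
      rw [Finset.mul_sum]
      refine Finset.sum_congr rfl fun j _ => ?_
      rw [map_div₀]
      field_simp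
    rw [h2, map_mul, h1, mul_one]

end

/-! ### Norms, and passage of rigid valuations to Kummer extensions -/

section

variable {p : ℕ} {F E : Type*} [Field F] [Field E] [Algebra F E] {a : F} {α : E}
  {B : ValuationSubring E} {v : PowerClassGroup p F}

/-- The valuation is invariant under the Galois group. -/
def IsGaloisInvariant (F : Type*) {E : Type*} [Field F] [Field E] [Algebra F E]
    (B : ValuationSubring E) : Prop :=
  ∀ (σ : Gal(E/F)) (y : E), B.valuation (σ y) = B.valuation y

theorem IsGaloisInvariant.valuation_norm_eq_one [FiniteDimensional F E] [IsGalois F E]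
    (hinv : IsGaloisInvariant F B) {y : E} (hy : B.valuation y = 1) :
    B.valuation (algebraMap F E (Algebra.norm F y)) = 1 := by
  rw [Algebra.norm_eq_prod_automorphisms, map_prod]
  exact Finset.prod_eq_one fun σ _ => (hinv σ y).trans hy

theorem valuation_one_sub_prod_lt_one {ι : Type*} (s : Finset ι) (f : ι → E)
    (hf : ∀ i ∈ s, B.valuation (1 - f i) < 1) : B.valuation (1 - ∏ i ∈ s, f i) < 1 := by
  refine Finset.prod_induction f (fun t => B.valuation (1 - t) < 1) (fun x y hx hy => ?_) (by simp)
    hf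
  rw [show 1 - x * y = (1 - x) + (1 - -(-(1 - x) * (1 - y) + (1 - y)) - 1) by ring]
  have h1 : B.valuation (-(1 - x) * (1 - y) + (1 - y)) < 1 := by
    refine Valuation.map_add_lt _ ?_ hy
    rw [map_mul, Valuation.map_neg]
    exact mul_lt_one_of_nonneg_of_lt_one_left zero_le hx hy.le
  refine Valuation.map_add_lt _ hx ?_
  rwa [show 1 - -(-(1 - x) * (1 - y) + (1 - y)) - 1 = -(1 - x) * (1 - y) + (1 - y) by ring]

/-- By Galois invariance all conjugates of y are congruent to 1, hence so is the norm. -/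
theorem IsRigidOver.powerClass_norm_eq_zero [FiniteDimensional F E] [IsGalois F E]
    (hB : IsRigidOver p F B v) (hinv : IsGaloisInvariant F B) {y : E}
    (hy : B.valuation (1 - y) < 1) : powerClass p (Algebra.norm F y) = 0 := by
  have h1 : B.valuation (1 - algebraMap F E (Algebra.norm F y)) < 1 := by
    rw [Algebra.norm_eq_prod_automorphisms]
    refine valuation_one_sub_prod_lt_one _ _ fun σ _ => ?_
    rw [← map_one σ, ← map_sub, hinv]
    exact hy
  have := hB.powerClass_one_sub (1 - Algebra.norm F y) (by rwa [map_sub, map_one])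
  rwa [sub_sub_cancel] at this

theorem IsKummerGenerator.powerClass_ne_zero (h : IsKummerGenerator p a α) (hp : p.Prime) :
    powerClass p a ≠ 0 := fun h' => h.notMem ((powerClass_eq_zero_iff hp.ne_zero).1 h')

theorem IsRigidOver.exists_smul_of_unit (hB : IsRigidOver p F B v) (hp : p.Prime)
    (ha0 : powerClass p a ≠ 0)
    (ha : B.valuation (algebraMap F E a) = 1) {x : F} (hx : B.valuation (algebraMap F E x) = 1) :
    ∃ k : ZMod p, powerClass p x = k • powerClass p a := by
  have : Fact p.Prime := ⟨hp⟩
  obtain ⟨l, hl⟩ := hB.exists_eq_smul a ha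
  obtain ⟨k, hk⟩ := hB.exists_eq_smul x hx
  have hl0 : l ≠ 0 := by
    rintro rfl
    rw [zero_smul] at hl
    exact ha0 hl
  refine ⟨k * l⁻¹, ?_⟩
  rw [hl, smul_smul, mul_assoc, inv_mul_cancel₀ hl0, mul_one, hk]

/-- After rescaling the generator, either the extension is totally ramified or the generator is a
unit. -/
theorem IsKummerGenerator.exists_normalized (h : IsKummerGenerator p a α) (hp : p.Prime) :
    ∃ (a' : F) (α' : E), IsKummerGenerator p a' α' ∧ powerClass p a' = powerClass p a ∧
      ((∀ c : F, B.valuation (algebraMap F E a') ≠ B.valuation (algebraMap F E c) ^ p) ∨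
        B.valuation α' = 1) := by
  by_cases hram : ∀ c : F, B.valuation (algebraMap F E a) ≠ B.valuation (algebraMap F E c) ^ p
  · exact ⟨a, α, h, rfl, Or.inl hram⟩
  push Not at hram
  obtain ⟨c, hc⟩ := hram
  have ha0 := h.ne_zero hp
  have hc0 : c ≠ 0 := by
    rintro rfl
    rw [map_zero, map_zero, zero_pow hp.ne_zero, map_eq_zero, map_eq_zero] at hc
    exact ha0 hc
  refine ⟨a / c ^ p, α / algebraMap F E c, h.div_algebraMap hc0, ?_, Or.inr ?_⟩
  · rw [powerClass_div ha0 (pow_ne_zero p hc0), powerClass_pow_self, sub_zero]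
  · have hcv : B.valuation (algebraMap F E c) ≠ 0 := by simpa using hc0
    have : B.valuation (α / algebraMap F E c) ^ p = 1 := by
      rw [map_div₀, div_pow, ← map_pow, h.pow_eq, hc, div_self (pow_ne_zero p hcv)]
    exact (pow_eq_one_iff.1 this).resolve_right hp.ne_zero

theorem IsKummerGenerator.valuation_eq_one (h : IsKummerGenerator p a α)
    (hα : B.valuation α = 1) : B.valuation (algebraMap F E a) = 1 := by
  rw [← h.pow_eq, map_pow, hα, one_pow]

theorem IsRigidOver.isValuationBasis (hB : IsRigidOver p F B v) (hp : p.Prime)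
    (h : IsKummerGenerator p a α)
    (h' : (∀ c : F, B.valuation (algebraMap F E a) ≠ B.valuation (algebraMap F E c) ^ p) ∨
        B.valuation α = 1) : IsValuationBasis p F B α := by
  rcases h' with h' | h'
  · exact h.isValuationBasis_of_ramified hp h'
  · exact h.isValuationBasis_of_unramified hp h'
      (hB.not_valuation_sub_pow_lt_one hp h.notMem (h.valuation_eq_one h'))

/-- In the ramified case y = cα^i(1 + z) has norm c^p a^i times a p-th power. In the unramified case
y is an element of F times a unit; the norm of the unit is a unit of F, whose class lies on the line
spanned by [a]. -/
theorem IsRigidOver.exists_powerClass_norm_eq (hB : IsRigidOver p F B v) (hp : p.Prime)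
    (hodd : Odd p) (hζ : ∃ ζ : F, IsPrimitiveRoot ζ p) (h : IsKummerGenerator p a α) (y : E) :
    ∃ k : ZMod p, powerClass p (Algebra.norm F y) = k • powerClass p a := by
  obtain ⟨a', α', h', haa', hcase⟩ := h.exists_normalized (B := B) hp
  rw [← haa']
  clear haa' h
  by_cases hy : y = 0
  · have := h'.finiteDimensional hp
    exact ⟨0, by rw [hy, Algebra.norm_zero]; simp⟩
  have := h'.finiteDimensional hp
  obtain ⟨hgal, -⟩ := h'.isGalois_and_isCyclic hp hζ
  have hbasis := hB.isValuationBasis hp h' hcase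
  have hinv : IsGaloisInvariant F B := hbasis.valuation_apply_eq h' hp hζ
  obtain ⟨c, rfl⟩ := h'.exists_eq_sum hp y
  rcases hcase with hram | hα
  · obtain ⟨i, -, hci, -, z, hz, hsum⟩ := h'.exists_eq_mul_one_add hp hram hy
    have hz1 : powerClass p (Algebra.norm F (1 + z)) = 0 := by
      refine hB.powerClass_norm_eq_zero hinv ?_
      rw [sub_add_cancel_left, Valuation.map_neg]
      exact hz
    have hz0 : Algebra.norm F (1 + z) ≠ 0 := by
      rw [Algebra.norm_ne_zero_iff]
      intro h0
      rw [h0, mul_zero] at hsum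
      exact hy hsum
    refine ⟨i, ?_⟩
    have ha0 := pow_ne_zero i (h'.ne_zero hp)
    have hc0 := pow_ne_zero p hci
    rw [hsum, map_mul, map_mul, map_pow, h'.norm_gen hp hodd, Algebra.norm_algebraMap,
      h'.finrank_eq hp, powerClass_mul (mul_ne_zero hc0 ha0) hz0, powerClass_mul hc0 ha0,
      powerClass_pow_self, powerClass_pow, hz1, zero_add, add_zero]
  · obtain ⟨i, -, hi, -⟩ := hbasis c
    have hci : c i ≠ 0 := by
      intro h0
      rw [h0, map_zero, zero_mul, map_zero, map_eq_zero] at hi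
      exact hy hi
    have hci' : algebraMap F E (c i) ≠ 0 := by simpa using hci
    obtain ⟨y, hy'⟩ : ∃ y, y = ∑ j ∈ Finset.range p, algebraMap F E (c j) * α' ^ j := ⟨_, rfl⟩
    rw [← hy'] at hi hy ⊢
    have h1 : B.valuation (y / algebraMap F E (c i)) = 1 := by
      rw [map_div₀, hi, map_mul, map_pow, hα, one_pow, mul_one, div_self]
      simpa using hci
    obtain ⟨k, hk⟩ := hB.exists_smul_of_unit hp (h'.powerClass_ne_zero hp)
      (h'.valuation_eq_one hα) (hinv.valuation_norm_eq_one h1)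
    refine ⟨k, ?_⟩
    have h2 : y = algebraMap F E (c i) * (y / algebraMap F E (c i)) := by field_simp
    have h3 : Algebra.norm F (y / algebraMap F E (c i)) ≠ 0 := by
      rw [Algebra.norm_ne_zero_iff]
      exact div_ne_zero hy hci'
    rw [h2, map_mul, Algebra.norm_algebraMap, h'.finrank_eq hp,
      powerClass_mul (pow_ne_zero p hci) h3, powerClass_pow_self, zero_add, hk]

theorem HasRigidValuation.isPRigidField (hF : HasRigidValuation p F) (hp : p.Prime)
    (hodd : Odd p) (hζ : ∃ ζ : F, IsPrimitiveRoot ζ p) : IsPRigidField p F := by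
  intro a ha
  rw [isPRigidElement_iff hp ha]
  have : Fact (Irreducible (X ^ p - C a : F[X])) :=
    ⟨irreducible_X_pow_sub_C_of_notMem_pthPowers hp ha⟩
  obtain ⟨B, v, hB⟩ := hF.exists_isRigidOver (AdjoinRoot (X ^ p - C a : F[X]))
  exact hB.exists_powerClass_norm_eq hp hodd hζ (isKummerGenerator_root ha)

theorem hasRigidValuation_of_forall (hp : p.Prime)
    (h1 : ∀ x : E, B.valuation (1 - x) < 1 → x ∈ pthPowers p E) (u : E) (hu : u ≠ 0)
    (h2 : ∀ x : E, B.valuation x = 1 → ∃ (k : ℕ) (c : E), x = u ^ k * c ^ p) :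
    HasRigidValuation p E :=
  ⟨B, powerClass p u,
    fun x hx => (powerClass_eq_zero_iff hp.ne_zero).2 (h1 _ (by rwa [sub_sub_cancel])),
    fun x hx => (exists_powerClass_eq_smul_iff hp hu).2 (h2 x hx)⟩

/-- The existence of a rigid valuation passes to Kummer extensions of degree `p`. -/
theorem HasRigidValuation.of_isKummerGenerator (hF : HasRigidValuation p F) (hp : p.Prime)
    (hodd : Odd p) (hζ : ∃ ζ : F, IsPrimitiveRoot ζ p) (h : IsKummerGenerator p a α) :
    HasRigidValuation p E := by
  obtain ⟨B, v, hB⟩ := hF.exists_isRigidOver E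
  obtain ⟨a', α', h', -, hcase⟩ := h.exists_normalized (B := B) hp
  clear h
  have := h'.finiteDimensional hp
  obtain ⟨hgal, -⟩ := h'.isGalois_and_isCyclic hp hζ
  have hbasis := hB.isValuationBasis hp h' hcase
  have hinv : IsGaloisInvariant F B := hbasis.valuation_apply_eq h' hp hζ
  have hα0 := h'.gen_ne_zero hp
  have hdec : ∀ y : E, y ≠ 0 → ∃ (i : ℕ) (f : F) (z : E),
      y = α' ^ i * algebraMap F E f * z ^ p := fun y hy =>
    h'.exists_eq_mul_pow hp hodd hζ (fun y => (exists_powerClass_eq_smul_iff hp (h'.ne_zero hp)).1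
      (hB.exists_powerClass_norm_eq hp hodd hζ h' y)) hy
  have hne : ∀ {x : E}, B.valuation x = 1 → x ≠ 0 := by
    rintro x hx rfl
    simp at hx
  have hone : ∀ {x : E}, B.valuation (1 - x) < 1 → B.valuation x = 1 := by
    intro x hx
    have := valuation_one_add_eq_one (z := -(1 - x)) (by rwa [Valuation.map_neg])
    rwa [show 1 + -(1 - x) = x by ring] at this
  rcases hcase with hram | hα
  -- Decompose x = α^i f y^p and replace y by its dominant term times 1 + z. Since x is a unit, p
  -- divides i, so the power of α is absorbed into F.
  · have key : ∀ x : E, B.valuation x = 1 → ∃ (f : F) (z : E), B.valuation z < 1 ∧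
        x = algebraMap F E f * (1 + z) ^ p := by
      intro x hx
      obtain ⟨i, f, y, hy⟩ := hdec x (hne hx)
      have hy0 : y ≠ 0 := by
        rintro rfl
        rw [zero_pow hp.ne_zero, mul_zero] at hy
        exact hne hx hy
      obtain ⟨c, rfl⟩ := h'.exists_eq_sum hp y
      obtain ⟨j, -, hcj, -, z, hz, hsum⟩ := h'.exists_eq_mul_one_add hp hram hy0
      obtain ⟨f', hf'⟩ : ∃ f', f' = f * c j ^ p * a' ^ j := ⟨_, rfl⟩
      have hx' : x = α' ^ i * algebraMap F E f' * (1 + z) ^ p := by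
        rw [hy, hsum, hf', map_mul, map_mul, map_pow, map_pow, ← h'.pow_eq, mul_pow, mul_pow]
        ring
      have hw : B.valuation (algebraMap F E f'⁻¹) = B.valuation α' ^ i := by
        have h1 := hx
        rw [hx', map_mul, map_mul, map_pow, map_pow, valuation_one_add_eq_one hz, one_pow,
          mul_one] at h1
        rw [map_inv₀, map_inv₀]
        exact (eq_inv_of_mul_eq_one_left h1).symm
      obtain ⟨m, rfl⟩ := h'.dvd_of_valuation_eq_pow hp hram hw
      refine ⟨a' ^ m * f', z, hz, ?_⟩
      rw [hx', map_mul, map_pow, ← h'.pow_eq]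
      ring
    have hfone : ∀ {f : F} {z : E}, B.valuation z < 1 →
        B.valuation (algebraMap F E f * (1 + z) ^ p) = B.valuation (algebraMap F E f) := by
      intro f z hz
      rw [map_mul, map_pow, valuation_one_add_eq_one hz, one_pow, mul_one]
    obtain ⟨u, hu0, rfl⟩ := exists_powerClass_eq v
    refine hasRigidValuation_of_forall hp (B := B) (fun x hx => ?_) (algebraMap F E u)
      (by simpa using hu0) fun x hx => ?_
    · obtain ⟨f, z, hz, rfl⟩ := key x (hone hx)
      have h1 : B.valuation (1 - (1 + z) ^ p) < 1 := by
        have := valuation_one_sub_prod_lt_one (B := B) (Finset.range p) (fun _ => 1 + z)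
          (fun _ _ => by rw [sub_add_cancel_left, Valuation.map_neg]; exact hz)
        simpa using this
      have h2 : B.valuation (algebraMap F E (1 - f)) < 1 := by
        have h3 : algebraMap F E (1 - f) = (1 - algebraMap F E f * (1 + z) ^ p) -
            algebraMap F E f * (1 - (1 + z) ^ p) := by
          rw [map_sub, map_one]; ring
        rw [h3]
        refine Valuation.map_sub_lt _ hx ?_
        rw [map_mul, ← hfone hz, hone hx, one_mul]
        exact h1
      have h4 := hB.powerClass_one_sub _ h2
      rw [sub_sub_cancel, powerClass_eq_zero_iff hp.ne_zero] at h4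
      obtain ⟨c, rfl⟩ := h4
      exact ⟨algebraMap F E c * (1 + z), by simp only [map_pow, mul_pow]⟩
    · obtain ⟨f, z, hz, rfl⟩ := key x hx
      rw [hfone hz] at hx
      obtain ⟨k, c, rfl⟩ := (exists_powerClass_eq_smul_iff hp hu0).1 (hB.exists_eq_smul f hx)
      exact ⟨k, algebraMap F E c * (1 + z), by simp only [map_pow, map_mul, mul_pow]; ring⟩
  -- Here f c_j^p is a unit of F, so its class is a multiple of [a]; since a = α^p, it becomes a
  -- p-th power in E.
  · have key : ∀ x : E, B.valuation x = 1 → ∃ (i : ℕ) (z : E), x = α' ^ i * z ^ p ∧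
        B.valuation z = 1 := by
      intro x hx
      obtain ⟨i, f, y, hy⟩ := hdec x (hne hx)
      have hy0 : y ≠ 0 := by
        rintro rfl
        rw [zero_pow hp.ne_zero, mul_zero] at hy
        exact hne hx hy
      obtain ⟨c, hc⟩ := h'.exists_eq_sum hp y
      obtain ⟨j, -, hj, -⟩ := hbasis c
      rw [← hc, map_mul _ _ (α' ^ j), map_pow, hα, one_pow, mul_one] at hj
      have hcj : algebraMap F E (c j) ≠ 0 := by
        intro h0
        rw [h0, map_zero, map_eq_zero] at hj
        exact hy0 hj
      have hf1 : B.valuation (algebraMap F E (f * c j ^ p)) = 1 := by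
        rw [hy, map_mul, map_mul, map_pow, map_pow, hα, one_pow, one_mul, hj] at hx
        rw [map_mul, map_mul, map_pow, map_pow, hx]
      obtain ⟨k, d, hkd⟩ := (exists_powerClass_eq_smul_iff hp (h'.ne_zero hp)).1
        (hB.exists_smul_of_unit hp (h'.powerClass_ne_zero hp) (h'.valuation_eq_one hα) hf1)
      have hx' : x = α' ^ i * (α' ^ k * algebraMap F E d * (y / algebraMap F E (c j))) ^ p := by
        have h1 : algebraMap F E f * algebraMap F E (c j) ^ p =
            (α' ^ p) ^ k * algebraMap F E d ^ p := by
          rw [h'.pow_eq, ← map_pow, ← map_pow, ← map_pow, ← map_mul, ← map_mul, hkd]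
        rw [hy, mul_pow, mul_pow, div_pow]
        field_simp
        linear_combination h1
      refine ⟨i, _, hx', ?_⟩
      rw [hx', map_mul, map_pow, map_pow, hα, one_pow, one_mul] at hx
      exact (pow_eq_one_iff.1 hx).resolve_right hp.ne_zero
    refine hasRigidValuation_of_forall hp (B := B) (fun x hx => ?_) α' hα0 fun x hx => ?_
    · obtain ⟨i, z, rfl, hz⟩ := key x (hone hx)
      -- The norm of x is a^i times a p-th power, and it is itself a p-th power because x is
      -- congruent to 1; hence p divides i.
      have h1 := hB.powerClass_norm_eq_zero hinv hx
      have hz0 : Algebra.norm F z ≠ 0 := Algebra.norm_ne_zero_iff.2 (hne hz)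
      have : Fact p.Prime := ⟨hp⟩
      rw [map_mul, map_pow, map_pow, h'.norm_gen hp hodd,
        powerClass_mul (pow_ne_zero i (h'.ne_zero hp)) (pow_ne_zero p hz0), powerClass_pow_self,
        add_zero, powerClass_pow, smul_eq_zero, ZMod.natCast_eq_zero_iff] at h1
      obtain ⟨m, rfl⟩ := h1.resolve_right (h'.powerClass_ne_zero hp)
      exact ⟨α' ^ m * z, by simp only [mul_pow]; ring⟩
    · obtain ⟨i, z, hz, -⟩ := key x hx
      exact ⟨i, z, hz⟩

end

/-! ### Reduction to finitely generated subfields -/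

section Descent

/-- Norms are compatible with base change along compatible bases. -/
theorem map_norm_eq_norm_map_of_basis {R S A B n : Type*} [CommRing R] [CommRing S] [CommRing A]
    [CommRing B] [Algebra R A] [Algebra S B] [Fintype n] [DecidableEq n] (ι : R →+* S)
    (f : A →+* B) (hf : ∀ r, f (algebraMap R A r) = algebraMap S B (ι r))
    (b : Module.Basis n R A) (c : Module.Basis n S B) (hbc : ∀ i, f (b i) = c i) (y : A) :
    ι (Algebra.norm R y) = Algebra.norm S (f y) := by
  rw [Algebra.norm_eq_matrix_det b, Algebra.norm_eq_matrix_det c, RingHom.map_det]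
  congr 1
  ext i j
  rw [RingHom.mapMatrix_apply, Matrix.map_apply, Algebra.leftMulMatrix_eq_repr_mul,
    Algebra.leftMulMatrix_eq_repr_mul]
  have h1 : f (y * b j) = ∑ i, ι (b.repr (y * b j) i) • c i := by
    conv_lhs => rw [← b.sum_repr (y * b j)]
    rw [map_sum]
    refine Finset.sum_congr rfl fun i _ => ?_
    rw [Algebra.smul_def, map_mul, hf, hbc, Algebra.smul_def]
  rw [← hbc j, ← map_mul, h1, c.repr_sum_self]

/-- The basis of powers of a Kummer generator. -/
noncomputable def IsKummerGenerator.basis {p : ℕ} {F E : Type*} [Field F] [Field E] [Algebra F E]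
    {a : F} {α : E} (h : IsKummerGenerator p a α) (hp : p.Prime) : Module.Basis (Fin p) F E :=
  (h.powerBasis hp).basis.reindex (finCongr (h.powerBasis_dim hp))

theorem IsKummerGenerator.basis_apply {p : ℕ} {F E : Type*} [Field F] [Field E] [Algebra F E]
    {a : F} {α : E} (h : IsKummerGenerator p a α) (hp : p.Prime) (i : Fin p) :
    h.basis hp i = α ^ (i : ℕ) := by
  simp [IsKummerGenerator.basis]

/-- A field is `p`-rigid if every finite subset is contained in a `p`-rigid subfield. -/
theorem isPRigidField_of_forall_finset {p : ℕ} (hp : p.Prime) {F Ω : Type*} [Field F] [Field Ω]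
    [Algebra F Ω] (K : IntermediateField F Ω)
    (hK : ∀ s : Finset Ω, (s : Set Ω) ⊆ K →
      ∃ K₀ : IntermediateField F Ω, K₀ ≤ K ∧ (s : Set Ω) ⊆ K₀ ∧ IsPRigidField p K₀) :
    IsPRigidField p K := by
  classical
  intro a ha
  refine ⟨ha, fun y => ?_⟩
  have : Fact (Irreducible (X ^ p - C a : K[X])) :=
    ⟨irreducible_X_pow_sub_C_of_notMem_pthPowers hp ha⟩
  have h := isKummerGenerator_root ha
  obtain ⟨c, hc⟩ := h.exists_eq_sum hp y
  -- The norm equation involves only a and the p coefficients of y, so it can be solved over a rigid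
  -- subfield containing them.
  obtain ⟨K₀, hle, hs, hrig⟩ := hK (insert (a : Ω) ((Finset.range p).image fun i => (c i : Ω)))
    (by
      intro x hx
      simp only [Finset.coe_insert, Finset.coe_image, Set.mem_insert_iff, Set.mem_image] at hx
      rcases hx with rfl | ⟨i, -, rfl⟩
      · exact a.2
      · exact (c i).2)
  have haK : (a : Ω) ∈ K₀ := hs (by simp)
  have hcK : ∀ i ∈ Finset.range p, (c i : Ω) ∈ K₀ := fun i hi => hs (by
    simp only [Finset.coe_insert, Finset.coe_image, Set.mem_insert_iff, Set.mem_image]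
    exact Or.inr ⟨i, hi, rfl⟩)
  let ι : K₀ →+* K := (IntermediateField.inclusion hle : K₀ →+* K)
  let a₀ : K₀ := ⟨a, haK⟩
  have hιa : ι a₀ = a := rfl
  have ha₀ : a₀ ∉ pthPowers p K₀ := by
    rintro ⟨d, hd⟩
    exact ha ⟨ι d, by simp only at hd ⊢; rw [← map_pow, hd, hιa]⟩
  have : Fact (Irreducible (X ^ p - C a₀ : K₀[X])) :=
    ⟨irreducible_X_pow_sub_C_of_notMem_pthPowers hp ha₀⟩
  have h₀ := isKummerGenerator_root ha₀
  let f : AdjoinRoot (X ^ p - C a₀ : K₀[X]) →+* AdjoinRoot (X ^ p - C a : K[X]) :=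
    AdjoinRoot.lift ((algebraMap K (AdjoinRoot (X ^ p - C a : K[X]))).comp ι)
      (AdjoinRoot.root (X ^ p - C a : K[X])) (by
        rw [eval₂_sub, eval₂_X_pow, eval₂_C, h.pow_eq, RingHom.comp_apply, hιa, sub_self])
  have hf : ∀ r, f (algebraMap K₀ (AdjoinRoot (X ^ p - C a₀ : K₀[X])) r) =
      algebraMap K (AdjoinRoot (X ^ p - C a : K[X])) (ι r) := fun r => AdjoinRoot.lift_of _
  have hfroot : f (AdjoinRoot.root _) = AdjoinRoot.root _ := AdjoinRoot.lift_root _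
  let y₀ : AdjoinRoot (X ^ p - C a₀ : K₀[X]) := ∑ i ∈ (Finset.range p).attach,
    algebraMap K₀ (AdjoinRoot (X ^ p - C a₀ : K₀[X])) ⟨c i, hcK i i.2⟩ *
      AdjoinRoot.root (X ^ p - C a₀ : K₀[X]) ^ (i : ℕ)
  have hy₀ : f y₀ = y := by
    rw [hc, ← Finset.sum_attach, map_sum]
    refine Finset.sum_congr rfl fun i _ => ?_
    rw [map_mul, map_pow, hf, hfroot]
    rfl
  obtain ⟨k, d, hkd⟩ := (hrig a₀ ha₀).2 y₀
  refine ⟨k, ι d, ?_⟩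
  rw [← hy₀, ← map_norm_eq_norm_map_of_basis ι f hf (h₀.basis hp) (h.basis hp) (fun i => by
    rw [h₀.basis_apply, h.basis_apply, map_pow, hfroot]) y₀]
  exact (congrArg ι hkd).trans (by rw [map_mul, map_pow, map_pow, hιa])

end Descent

/-! ### Climbing p-extensions -/

section Tower

theorem HasRigidValuation.of_ringEquiv {p : ℕ} (hp : p.Prime) {F E : Type*} [Field F] [Field E]
    (hF : HasRigidValuation p F) (e : F ≃+* E) : HasRigidValuation p E := by
  obtain ⟨A, v, h1, h2⟩ := hF
  let : Algebra E F := (e.symm : E →+* F).toAlgebra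
  have he : ∀ x, algebraMap E F x = e.symm x := fun x => rfl
  obtain ⟨u, hu0, rfl⟩ := exists_powerClass_eq v
  refine hasRigidValuation_of_forall hp (B := A.comap (algebraMap E F)) (fun x hx => ?_) (e u)
    (by simpa using hu0) fun x hx => ?_
  · have h3 := h1 _ (ValuationSubring.valuation_comap_lt_one_iff.1 hx)
    rw [map_sub, map_one, sub_sub_cancel, powerClass_eq_zero_iff hp.ne_zero] at h3
    obtain ⟨c, hc⟩ := h3
    refine ⟨e c, ?_⟩
    simp only at hc ⊢
    rw [← map_pow, hc, he, e.apply_symm_apply]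
  · obtain ⟨k, c, hc⟩ := (exists_powerClass_eq_smul_iff hp hu0).1
      (h2 _ (ValuationSubring.valuation_comap_eq_one_iff.1 hx))
    refine ⟨k, e c, ?_⟩
    rw [← map_pow, ← map_pow, ← map_mul, ← hc, he, e.apply_symm_apply]

theorem exists_isKummerGenerator {p : ℕ} (hp : p.Prime) {K L : Type*} [Field K] [Field L]
    [Algebra K L] [IsGalois K L] (hKL : Module.finrank K L = p)
    (hζ : ∃ ζ : K, IsPrimitiveRoot ζ p) : ∃ (a : K) (α : L), IsKummerGenerator p a α := by
  have : Fact p.Prime := ⟨hp⟩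
  have : FiniteDimensional K L := Module.finite_of_finrank_pos (hKL ▸ hp.pos)
  have : IsCyclic Gal(L/K) := isCyclic_of_prime_card (p := p) (by
    rw [IsGalois.card_aut_eq_finrank, hKL])
  obtain ⟨ζ, hζ⟩ := hζ
  have hprim : (primitiveRoots (Module.finrank K L) K).Nonempty := by
    rw [hKL]
    exact ⟨ζ, (mem_primitiveRoots hp.pos).2 hζ⟩
  obtain ⟨α, ⟨a, ha⟩, hα⟩ := exists_root_adjoin_eq_top_of_isCyclic K L hprim
  have hirr := irreducible_X_pow_sub_C_of_root_adjoin_eq_top ha.symm hα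
  rw [hKL] at ha hirr
  refine ⟨a, α, ?_, ha.symm, hα⟩
  rintro ⟨c, hc⟩
  exact pow_ne_of_irreducible_X_pow_sub_C hirr dvd_rfl hp.ne_one c hc

/-- A subgroup of index p in a p-group is normal, its index being the smallest prime factor of the
order. -/
theorem isGalois_extendScalars_of_finrank_eq {p : ℕ} (hp : p.Prime) {F N : Type*} [Field F]
    [Field N] [Algebra F N] [FiniteDimensional F N] [IsGalois F N] {n : ℕ}
    (hN : Module.finrank F N = p ^ (n + 1)) (K : IntermediateField F N)
    (hK : Module.finrank F K = p) : IsGalois F K := by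
  have hnormal : K.fixingSubgroup.Normal := by
    refine Subgroup.normal_of_index_eq_minFac_card ?_
    rw [← IntermediateField.finrank_eq_fixingSubgroup_index, hK, IsGalois.card_aut_eq_finrank, hN,
      hp.pow_minFac n.succ_ne_zero]
  have := IsGalois.of_fixedField_normal_subgroup K.fixingSubgroup
  rwa [IsGalois.fixedField_fixingSubgroup] at this

/-- Induction on the index: by Sylow theory H has index p in some H', and Kummer theory presents the
fixed field of H as a degree p Kummer extension of that of H'. -/
theorem HasRigidValuation.fixedField {p : ℕ} (hp : p.Prime) (hodd : Odd p) {F N : Type*} [Field F]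
    [Field N] [Algebra F N] [FiniteDimensional F N] [IsGalois F N]
    (hζ : ∃ ζ : F, IsPrimitiveRoot ζ p) (hF : HasRigidValuation p F) {n : ℕ}
    (hN : Module.finrank F N = p ^ n) (m : ℕ) :
    ∀ H : Subgroup Gal(N/F), H.index = p ^ m →
      HasRigidValuation p (IntermediateField.fixedField H) := by
  have : Fact p.Prime := ⟨hp⟩
  have hG : Nat.card Gal(N/F) = p ^ n := by rw [IsGalois.card_aut_eq_finrank, hN]
  induction m with
  | zero =>
    intro H hH
    rw [pow_zero, Subgroup.index_eq_one] at hH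
    rw [hH, IsGalois.fixedField_top]
    exact hF.of_ringEquiv hp (IntermediateField.botEquiv F N).symm.toRingEquiv
  | succ m ih =>
    intro H hH
    have hcard := H.card_mul_index
    obtain ⟨l, hl, hHl⟩ := (Nat.dvd_prime_pow hp).1 (hG ▸ H.card_subgroup_dvd_card)
    rw [hG, hHl, hH, ← pow_add] at hcard
    have hlm : l + (m + 1) = n := Nat.pow_right_injective hp.two_le hcard
    obtain ⟨H', hH', hHH'⟩ := Sylow.exists_subgroup_card_pow_succ (p := p) (n := l)
      (by rw [hG]; exact pow_dvd_pow p (by omega)) hHl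
    have hindex : H'.index = p ^ m := by
      have h1 := H'.card_mul_index
      rw [hG, hH', ← hlm, show l + (m + 1) = l + 1 + m by ring, pow_add p (l + 1)] at h1
      exact Nat.eq_of_mul_eq_mul_left (pow_pos hp.pos _) h1
    have hle : IntermediateField.fixedField H' ≤ IntermediateField.fixedField H :=
      IntermediateField.fixedField_antitone hHH'
    have h1 : Module.finrank (IntermediateField.fixedField H') N = p ^ (l + 1) := by
      rw [IntermediateField.finrank_fixedField_eq_card, hH']
    have h2 : Module.finrank (IntermediateField.fixedField H) N = p ^ l := by
      rw [IntermediateField.finrank_fixedField_eq_card, hHl]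
    let K := IntermediateField.extendScalars hle
    have h3 : Module.finrank (IntermediateField.fixedField H') K = p := by
      have h4 := Module.finrank_mul_finrank (IntermediateField.fixedField H') K N
      have h5 : Module.finrank K N = p ^ l := h2
      rw [h5, h1, pow_succ'] at h4
      exact Nat.eq_of_mul_eq_mul_right (pow_pos hp.pos _) h4
    have hζ' : ∃ ζ : IntermediateField.fixedField H', IsPrimitiveRoot ζ p := by
      obtain ⟨ζ, hζ⟩ := hζ
      exact ⟨_, hζ.map_of_injective (algebraMap F (IntermediateField.fixedField H')).injective⟩
    have := isGalois_extendScalars_of_finrank_eq hp h1 K h3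
    obtain ⟨a, α, h⟩ := exists_isKummerGenerator hp h3 hζ'
    have h6 : HasRigidValuation p K := (ih H' hindex).of_isKummerGenerator hp hodd hζ' h
    exact h6

theorem HasRigidValuation.intermediateField {p : ℕ} (hp : p.Prime) (hodd : Odd p) {F N : Type*}
    [Field F] [Field N] [Algebra F N] [FiniteDimensional F N] [IsGalois F N]
    (hζ : ∃ ζ : F, IsPrimitiveRoot ζ p) (hF : HasRigidValuation p F) {n : ℕ}
    (hN : Module.finrank F N = p ^ n) (K : IntermediateField F N) : HasRigidValuation p K := by
  obtain ⟨m, -, hm⟩ := (Nat.dvd_prime_pow hp).1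
    (show K.fixingSubgroup.index ∣ p ^ n by
      rw [← hN, ← IsGalois.card_aut_eq_finrank]
      exact K.fixingSubgroup.index_dvd_card)
  have := hF.fixedField hp hodd hζ hN m K.fixingSubgroup hm
  rwa [IsGalois.fixedField_fixingSubgroup] at this

/-- Because the group fixing L is normal, the degree of the compositum over K divides the degree of
L over F. This makes the finite Galois p-extensions a directed family. -/
theorem exists_finrank_sup_eq_pow {p : ℕ} (hp : p.Prime) {F Ω : Type*} [Field F] [Field Ω]
    [Algebra F Ω] [IsGalois F Ω] (K L : IntermediateField F Ω) [IsGalois F L]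
    (hK : ∃ n : ℕ, Module.finrank F K = p ^ n) (hL : ∃ n : ℕ, Module.finrank F L = p ^ n) :
    ∃ n : ℕ, Module.finrank F (K ⊔ L : IntermediateField F Ω) = p ^ n := by
  obtain ⟨m, hm⟩ := hK
  obtain ⟨n, hn⟩ := hL
  rw [IntermediateField.finrank_eq_fixingSubgroup_index] at hm hn
  have h1 := Subgroup.relIndex_mul_index
    (inf_le_left : K.fixingSubgroup ⊓ L.fixingSubgroup ≤ K.fixingSubgroup)
  rw [Subgroup.inf_relIndex_left] at h1
  have h2 := Subgroup.relIndex_dvd_index_of_normal L.fixingSubgroup K.fixingSubgroup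
  rw [hn] at h2
  obtain ⟨l, -, hl⟩ := (Nat.dvd_prime_pow hp).1 h2
  refine ⟨l + m, ?_⟩
  rw [IntermediateField.finrank_eq_fixingSubgroup_index, IntermediateField.fixingSubgroup_sup, ← h1,
    hl, hm, pow_add]

/-- A finitely generated subextension of the maximal `p`-extension lies in a finite Galois
`p`-extension. -/
theorem exists_le_of_adjoin_le_maximalPExtension {p : ℕ} (hp : p.Prime) {F : Type*} [Field F]
    (s : Finset (SeparableClosure F))
    (hs : IntermediateField.adjoin F (s : Set (SeparableClosure F)) ≤ maximalPExtension p F) :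
    ∃ N : IntermediateField F (SeparableClosure F), FiniteDimensional F N ∧ IsGalois F N ∧
      (∃ n : ℕ, Module.finrank F N = p ^ n) ∧
      IntermediateField.adjoin F (s : Set (SeparableClosure F)) ≤ N := by
  have hcomp := IntermediateField.adjoin_finset_isCompactElement (F := F) s
  rw [CompleteLattice.isCompactElement_iff_le_of_directed_sSup_le] at hcomp
  have hne : {K : IntermediateField F (SeparableClosure F) |
      FiniteDimensional F K ∧ IsGalois F K ∧ ∃ n : ℕ, Module.finrank F K = p ^ n}.Nonempty :=
    ⟨⊥, inferInstance, inferInstance, 0, by simp⟩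
  obtain ⟨N, ⟨h1, h2, h3⟩, h4⟩ := hcomp _ hne (by
    rintro K ⟨hK1, hK2, hK3⟩ L ⟨hL1, hL2, hL3⟩
    exact ⟨K ⊔ L, ⟨inferInstance, inferInstance, exists_finrank_sup_eq_pow hp K L hK3 hL3⟩,
      le_sup_left, le_sup_right⟩) hs
  exact ⟨N, h1, h2, h3, h4⟩

theorem HasRigidValuation.isHereditarilyPRigid {p : ℕ} (hp : p.Prime) (hodd : Odd p) {F : Type*}
    [Field F] (hζ : ∃ ζ : F, IsPrimitiveRoot ζ p) (hF : HasRigidValuation p F) :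
    IsHereditarilyPRigid p F := by
  intro K hK
  refine isPRigidField_of_forall_finset hp K fun s hs => ?_
  have hle : IntermediateField.adjoin F (s : Set (SeparableClosure F)) ≤ K :=
    IntermediateField.adjoin_le_iff.2 hs
  refine ⟨_, hle, IntermediateField.subset_adjoin F _, ?_⟩
  obtain ⟨N, h1, h2, ⟨n, hn⟩, hN⟩ := exists_le_of_adjoin_le_maximalPExtension hp s (hle.trans hK)
  have h3 := hF.intermediateField hp hodd hζ hn (IntermediateField.restrict hN)
  have h4 := h3.of_ringEquiv hp (IntermediateField.restrictAlgEquiv hN).symm.toRingEquiv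
  obtain ⟨ζ, hζ⟩ := hζ
  exact h4.isPRigidField hp hodd ⟨_, hζ.map_of_injective (algebraMap F _).injective⟩

end Tower

theorem mainTheorem2 (p : ℕ) (hp : p.Prime) (hodd : p ≠ 2)
    (F : Type*) [Field F] (hζ : ∃ ζ : F, IsPrimitiveRoot ζ p)
    (hF : IsPRigidField p F) :
    IsHereditarilyPRigid p F ∧
      ∀ a : F, a ∉ pthPowers p F →
        ∀ (E : Type*) [Field E] [Algebra F E] (α : E),
          α ^ p = algebraMap F E a → IntermediateField.adjoin F {α} = ⊤ →
            IsPRigidField p E := by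
  have hodd' : Odd p := hp.odd_of_ne_two hodd
  have : Fact p.Prime := ⟨hp⟩
  have hval : HasRigidValuation p F := (hF.isAdditivelyRigid hp).hasRigidValuation hodd'
  refine ⟨hval.isHereditarilyPRigid hp hodd' hζ, fun a ha E _ _ α hα htop => ?_⟩
  have h := hval.of_isKummerGenerator hp hodd' hζ ⟨ha, hα, htop⟩
  obtain ⟨ζ, hζ⟩ := hζ
  exact h.isPRigidField hp hodd' ⟨_, hζ.map_of_injective (algebraMap F E).injective⟩
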